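/- Consider a state-space model with hidden states $x_s\in\mathbb R^{n}$ ($s\ge 0$) and outputs $y_s\in\mathcal Y$ ($s\ge 1$): $x_0$ has law $\pi_0$; given the past, $x_{s+1}$ has law $K_s(\cdot\mid x_s)$ for a Markov transition kernel $K_s$; and given the past and $x_s$, the output $y_s$ has density $\rho_s(\cdot\mid x_s)$ with respect to a $\sigma$-finite reference measure on $\mathcal Y$ (such as Lebesgue measure). For outputs $y_{1:t}$ let $\pi_{t|t}$ be the optimal filter, given by $\pi_{0|0}=\pi_0$ and $$(\pi_{s+1|s},\phi)=(\pi_{s|s},K_s\phi),\qquad (\pi_{s+1|s+1},\phi)=\frac{(\pi_{s+1|s},\phi\,\rho_{s+1}(y_{s+1}\mid\cdot))}{(\pi_{s+1|s},\rho_{s+1}(y_{s+1}\mid\cdot))}.$$ The particle filter with $N$ particles draws $x_0^1,\dots,x_0^N$ independently from $\pi_0$. At each time $s\ge1$ it moves the particles independently with the transition kernel, gives the moved particles $x_s^i$ the weights $\bar\omega_s^i=\rho_s(y_s\mid x_s^i)/\sum_j\rho_s(y_s\mid x_s^j)$ (and $\bar\omega_s^i=1/N$ if all these likelihoods vanish),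 and then resamples, drawing $N$ particles independently from $\sum_i\bar\omega_s^i\delta_{x_s^i}$. Put $\pi^N_{t|t}=\sum_i\bar\omega_t^i\delta_{x_t^i}$ and $\hat x_t^N=\sum_i\bar\omega_t^i x_t^i$. Let $t\ge1$. 1. The filter is the conditional law of the state. For every random process $(x,y)$ that obeys the model and every measurable $\phi:\mathbb R^n\to\mathbb R$ with $\phi(x_t)$ integrable, $\mathbb E[\phi(x_t)\mid y_{1:t}]=\int\phi\,d\pi_{t|t}$ almost surely. In particular $\mathbb E[x_t\mid y_{1:t}]=\int x\,d\pi_{t|t}$ almost surely if $x_t$ is integrable. 2. Fix outputs $y_{1:t}$ such that, for $1\le s\le t$, the function $x\mapsto\rho_s(y_s\mid x)$ is bounded and $(\pi_{s|s-1},\rho_s(y_s\mid\cdot))>0$. (a) For every measurable $\phi:\mathbb R^n\to\mathbb R$ whose fourth moment under the unconditional law of $x_t$ is finite, $\phi$ is $\pi_{t|t}$-integrable, and there is a constant $C_\phi$, not depending on $N$, such that for all $N\ge 1$ $$\mathbb E\Bigl[\Bigl|\int\phi\,d\pi^N_{t|t}-\int\phi\,d\pi_{t|t}\Bigr|^4\Bigr]\le\frac{C_\phi}{N^2},$$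 where the expectation is over the particles. (b) If $\mathbb E\|x_t\|^4<\infty$ (unconditional law), then $\hat x_t=\int x\,d\pi_{t|t}$ exists and $\hat x_t^N\to\hat x_t$ with probability $1$ as $N\to\infty$, whatever the joint law of the particle systems for different $N$. -/

import Mathlib

open MeasureTheory ProbabilityTheory Filter Topology
open scoped NNReal ENNReal

/-- A state-space model with hidden states in `𝓧` and outputs in `𝓨`: the law of the initial state
`x₀`, the Markov transition kernel `trans s` from the state at time `s` to the state at time
`s + 1`, and, for each time `s`, the density `lik s x` of the output `y_s` given `x_s = x`, with
respect to the reference measure `lam` (Lebesgue measure when `𝓨` is a Euclidean space or `ℂ`). -/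
structure StateSpaceModel (𝓧 𝓨 : Type*) [MeasurableSpace 𝓧] [MeasurableSpace 𝓨]
    (lam : Measure 𝓨) where
  /-- law of the initial state -/
  init : Measure 𝓧
  prob_init : IsProbabilityMeasure init
  /-- transition kernel from time `s` to time `s + 1` -/
  trans : ℕ → Kernel 𝓧 𝓧
  markov_trans : ∀ s, IsMarkovKernel (trans s)
  /-- `lik s x y` is the density at `y` of the output at time `s` when the state is `x` -/
  lik : ℕ → 𝓧 → 𝓨 → ℝ≥0
  measurable_lik : ∀ s, Measurable (Function.uncurry (lik s))
  lintegral_lik : ∀ s x, ∫⁻ y, lik s x y ∂lam = 1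

/-- The law of a finite family of independent variables depends measurably on the laws of its
members. -/
theorem measurable_pi_of_measurable {α 𝓧 : Type*} [MeasurableSpace α] [MeasurableSpace 𝓧] {N : ℕ}
    (κ : Fin N → α → Measure 𝓧) [∀ i a, IsFiniteMeasure (κ i a)] (hκ : ∀ i, Measurable (κ i)) :
    Measurable fun a => Measure.pi (fun i => κ i a) := by
  refine Measurable.measure_of_isPiSystem generateFrom_pi.symm isPiSystem_pi ?_ ?_
  · rintro _ ⟨t, ht, rfl⟩
    simp only [Measure.pi_pi]
    exact Finset.measurable_prod _ fun i _ =>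
      (Measure.measurable_coe (ht i (Set.mem_univ i))).comp (hκ i)
  · simp only [Measure.pi_univ]
    exact Finset.measurable_prod _ fun i _ =>
      (Measure.measurable_coe MeasurableSet.univ).comp (hκ i)

section Particles

variable {𝓧 : Type*} [MeasurableSpace 𝓧] {N : ℕ}

/-- The normalized importance weight of the `i`-th particle of the cloud `x`, for the unnormalized
weights `g (x i)`. In the degenerate case that all the unnormalized weights vanish, the normalized
weights are all taken to be `1 / N`. -/
noncomputable def normWeight (g : 𝓧 → ℝ≥0) (x : Fin N → 𝓧) (i : Fin N) : ℝ≥0 :=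
  if ∑ j, g (x j) = 0 then (N : ℝ≥0)⁻¹ else g (x i) / ∑ j, g (x j)

theorem measurable_normWeight {g : 𝓧 → ℝ≥0} (hg : Measurable g) (i : Fin N) :
    Measurable fun x : Fin N → 𝓧 => normWeight g x i := by
  have hs : Measurable fun x : Fin N → 𝓧 => ∑ j, g (x j) :=
    Finset.measurable_sum _ fun j _ => hg.comp (measurable_pi_apply j)
  exact Measurable.ite (hs (measurableSet_singleton 0)) measurable_const
    ((hg.comp (measurable_pi_apply i)).div hs)

/-- The weighted particle measure: the sum over `i` of the normalized weight of the `i`-th particle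
times the unit mass at that particle. -/
noncomputable def particleMeasure (g : 𝓧 → ℝ≥0) (x : Fin N → 𝓧) : Measure 𝓧 :=
  ∑ i, (normWeight g x i : ℝ≥0∞) • Measure.dirac (x i)

instance (g : 𝓧 → ℝ≥0) (x : Fin N → 𝓧) : IsFiniteMeasure (particleMeasure g x) := by
  refine ⟨?_⟩
  simp only [particleMeasure, Measure.coe_finsetSum, Finset.sum_apply, Measure.smul_apply,
    measure_univ, smul_eq_mul, mul_one]
  exact ENNReal.sum_lt_top.2 fun i _ => ENNReal.coe_lt_top

theorem measurable_particleMeasure {g : 𝓧 → ℝ≥0} (hg : Measurable g) :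
    Measurable fun x : Fin N → 𝓧 => particleMeasure g x := by
  refine Measure.measurable_of_measurable_coe _ fun s hs => ?_
  simp only [particleMeasure, Measure.coe_finsetSum, Finset.sum_apply, Measure.smul_apply,
    smul_eq_mul]
  exact Finset.measurable_sum _ fun i _ => (measurable_normWeight hg i).coe_nnreal_ennreal.mul
    ((Measure.measurable_coe hs).comp (Measure.measurable_dirac.comp (measurable_pi_apply i)))

/-- The resampling step: given the weighted cloud, the `N` new particles are drawn independently
from the weighted particle measure. -/
noncomputable def resample (N : ℕ) (g : 𝓧 → ℝ≥0) (hg : Measurable g) :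
    Kernel (Fin N → 𝓧) (Fin N → 𝓧) where
  toFun x := Measure.pi fun _ => particleMeasure g x
  measurable' := measurable_pi_of_measurable _ fun _ => measurable_particleMeasure hg

/-- The prediction step: given the cloud, the `i`-th particle is moved according to the transition
kernel, independently of the others. -/
noncomputable def propagate (N : ℕ) (κ : Kernel 𝓧 𝓧) [IsMarkovKernel κ] :
    Kernel (Fin N → 𝓧) (Fin N → 𝓧) where
  toFun x := Measure.pi fun i => κ (x i)
  measurable' := measurable_pi_of_measurable (fun (i : Fin N) (x : Fin N → 𝓧) => κ (x i)) fun i =>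
    κ.measurable.comp (measurable_pi_apply i)

/-- Bayes' rule: reweight the probability measure `μ` by the likelihood `g` and normalize. -/
noncomputable def bayesUpdate (g : 𝓧 → ℝ≥0) (μ : Measure 𝓧) : Measure 𝓧 :=
  (∫⁻ x, g x ∂μ)⁻¹ • μ.withDensity fun x => (g x : ℝ≥0∞)

end Particles

namespace StateSpaceModel

variable {𝓧 𝓨 : Type*} [MeasurableSpace 𝓧] [MeasurableSpace 𝓨] {lam : Measure 𝓨}

instance (M : StateSpaceModel 𝓧 𝓨 lam) : IsProbabilityMeasure M.init := M.prob_init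

instance (M : StateSpaceModel 𝓧 𝓨 lam) (s : ℕ) : IsMarkovKernel (M.trans s) := M.markov_trans s

theorem measurable_lik_left (M : StateSpaceModel 𝓧 𝓨 lam) (s : ℕ) (y : 𝓨) :
    Measurable fun x => M.lik s x y :=
  (M.measurable_lik s).comp (measurable_id.prodMk measurable_const)

/-- The conditional law of the output at time `s` given the state at time `s`. -/
noncomputable def obsKernel [SFinite lam] (M : StateSpaceModel 𝓧 𝓨 lam) (s : ℕ) : Kernel 𝓧 𝓨 :=
  Kernel.withDensity (Kernel.const 𝓧 lam) fun x y => (M.lik s x y : ℝ≥0∞)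

instance [SFinite lam] (M : StateSpaceModel 𝓧 𝓨 lam) (s : ℕ) : IsMarkovKernel (M.obsKernel s) := by
  refine ⟨fun x => ⟨?_⟩⟩
  have h : Measurable (Function.uncurry fun x y => (M.lik s x y : ℝ≥0∞)) :=
    (M.measurable_lik s).coe_nnreal_ennreal
  rw [obsKernel, Kernel.withDensity_apply' _ h]
  simpa using M.lintegral_lik s x

/-- The random variable consisting of the states `x₀, …, x_a` and of the outputs `y₁, …, y_b`. -/
def history {Ω : Type*} (X : ℕ → Ω → 𝓧) (Y : ℕ → Ω → 𝓨) (a b : ℕ) (ω : Ω) :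
    (Fin (a + 1) → 𝓧) × (Fin b → 𝓨) :=
  (fun i => X i ω, fun j => Y (j + 1) ω)

/-- `(X, Y)` is a random process that obeys the state-space model: `X 0` has the initial law; given
the states and outputs up to time `s`, the state at time `s + 1` has the law given by the transition
kernel; given in addition that state, the output at time `s + 1` has the prescribed density. There is
no output at time `0`. -/
structure IsHiddenMarkov [SFinite lam] (M : StateSpaceModel 𝓧 𝓨 lam) {Ω : Type*} [MeasurableSpace Ω]
    (P : Measure Ω) (X : ℕ → Ω → 𝓧) (Y : ℕ → Ω → 𝓨) : Prop where
  measurable_state : ∀ s, Measurable (X s)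
  measurable_output : ∀ s, Measurable (Y s)
  init : HasLaw (X 0) M.init P
  trans : ∀ s, HasCondDistrib (X (s + 1)) (history X Y s s)
    ((M.trans s).comap (fun h : (Fin (s + 1) → 𝓧) × (Fin s → 𝓨) => h.1 (Fin.last s))
      (by fun_prop)) P
  obs : ∀ s, HasCondDistrib (Y (s + 1)) (history X Y (s + 1) s)
    ((M.obsKernel (s + 1)).comap
      (fun h : (Fin (s + 1 + 1) → 𝓧) × (Fin s → 𝓨) => h.1 (Fin.last (s + 1))) (by fun_prop)) P

/-- The σ-algebra generated by the outputs `Y 1, …, Y t`. -/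
@[reducible] def outputSigma {Ω : Type*} (Y : ℕ → Ω → 𝓨) (t : ℕ) : MeasurableSpace Ω :=
  MeasurableSpace.comap (fun ω (j : Fin t) => Y (j + 1) ω) inferInstance

/-- The unconditional law of the state at time `s`. -/
noncomputable def stateLaw (M : StateSpaceModel 𝓧 𝓨 lam) : ℕ → Measure 𝓧
  | 0 => M.init
  | s + 1 => (M.stateLaw s).bind (M.trans s)

/-- The optimal filter `π_{s|s}` for the outputs `y 1, …, y s`: the conditional law of the state at
time `s` given these outputs, through the prediction and update recursion. -/
noncomputable def filter (M : StateSpaceModel 𝓧 𝓨 lam) (y : ℕ → 𝓨) : ℕ → Measure 𝓧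
  | 0 => M.init
  | s + 1 => bayesUpdate (fun x => M.lik (s + 1) x (y (s + 1)))
      ((M.filter y s).bind (M.trans s))

/-- The optimal predictor `π_{s+1|s}`: the conditional law of the state at time `s + 1` given the
outputs `y 1, …, y s`. -/
noncomputable def predictor (M : StateSpaceModel 𝓧 𝓨 lam) (y : ℕ → 𝓨) (s : ℕ) : Measure 𝓧 :=
  (M.filter y s).bind (M.trans s)

/-- The law of the cloud of `N` particles at time `s` after the resampling step, when the filter is
run with the outputs `y 1, …, y s`. At time `0` the particles are independent draws from the initial
law. At each later time they are moved, weighted with the likelihood, and resampled. -/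
noncomputable def resampledLaw (M : StateSpaceModel 𝓧 𝓨 lam) (y : ℕ → 𝓨) (N : ℕ) :
    ℕ → Measure (Fin N → 𝓧)
  | 0 => Measure.pi fun _ => M.init
  | s + 1 => ((M.resampledLaw y N s).bind (propagate N (M.trans s))).bind
      (resample N (fun x => M.lik (s + 1) x (y (s + 1))) (M.measurable_lik_left _ _))

/-- The law of the cloud of `N` particles at time `s`, as used for the estimate at time `s`: at time
`s ≥ 1` this is the cloud after the particles have been moved and before they are resampled. -/
noncomputable def particleLaw (M : StateSpaceModel 𝓧 𝓨 lam) (y : ℕ → 𝓨) (N : ℕ) :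
    ℕ → Measure (Fin N → 𝓧)
  | 0 => Measure.pi fun _ => M.init
  | s + 1 => (M.resampledLaw y N s).bind (propagate N (M.trans s))

/-- The particle approximation `π^N_{t|t}` of the optimal filter, as a function of the cloud `x` of
particles at time `t`. -/
noncomputable def particleFilter (M : StateSpaceModel 𝓧 𝓨 lam) (y : ℕ → 𝓨) (t : ℕ) {N : ℕ}
    (x : Fin N → 𝓧) : Measure 𝓧 :=
  particleMeasure (fun z => M.lik t z (y t)) x

/-- The particle-filter estimate of the state at time `t`, as a function of the cloud `x` of
particles at time `t`: the weighted sum of the particles. -/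
noncomputable def particleEstimate {n : ℕ} (M : StateSpaceModel (EuclideanSpace ℝ (Fin n)) 𝓨 lam)
    (y : ℕ → 𝓨) (t : ℕ) {N : ℕ} (x : Fin N → EuclideanSpace ℝ (Fin n)) :
    EuclideanSpace ℝ (Fin n) :=
  ∑ i, (normWeight (fun z => M.lik t z (y t)) x i : ℝ) • x i

end StateSpaceModel

/-!
### Why the particle filter converges

*The filter is the conditional law.* Let `κ` be the kernel that sends `y 1, …, y s` to the filter
`π_{s|s}`. Induction on `s` shows that the law of `(Y 1, …, Y s, X s)` is the law of the outputs
composed with `κ` (`StateSpaceModel.IsHiddenMarkov.lintegral_eq`). In the induction step both sides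
are written, by `IsHiddenMarkov.lintegral_succ`, as integrals over the outputs up to time `s` and a
new output `y` against the reference measure, and they agree because the normalizer in Bayes' rule
cancels for almost every `y`. Uniqueness of conditional distributions does the rest.

*The fourth-moment bound.* The test function `φ` is unbounded and the random normalizer
`∑ j, ρ (x j)` of the weights can be arbitrarily small, so moment bounds alone do not pass through
the reweighting step. On the event that the normalizer is at least half its limit there is no
difficulty: if `φ` is centred for the filter, then `φ * ρ` is centred for the predictor, and the
normalized estimate is at most a constant times the unnormalized one. On the complementary event the
estimate is only bounded by `∑ i, |φ (x i)|`, so one needs that this event is very unlikely *even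
after weighting by the sum of an unbounded integrable function over the particles*. The induction
therefore carries three properties of a random cloud at once (`IsControlled`): a first-moment bound,
a fourth-moment bound for centred functions, and the property that for bounded `g` with
`∫ g dμ < 0` the quantity `E[1{∑ i, g (x i) ≥ 0} * ∑ i, h (x i)]` decreases faster than every power of
`N`. The last one is stable under the dynamics. Drawing independent particles preserves it by a
Chernoff bound in which the weight `h (x i)` only affects one factor of the product measure
(`setLIntegral_pi_sum_le`). Reweighting preserves it up to a factor `N`, since `∫ g d(Bayes μ) < 0` is
equivalent to `∫ g ρ dμ < 0` and the sign of a weighted sum does not see its normalizer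
(`IsControlled.reweighting`). A transition kernel just replaces `g` and `h` by their averages
(`IsControlled.propagation`). The fourth moment of a sum of independent centred variables gives the
rate `N⁻²` (`lintegral_pi_enorm_sum_pow_four_le`).

*Almost sure convergence.* The rate `N⁻²` is summable, so the first Borel–Cantelli argument applies to
every coordinate, whatever the joint law of the clouds.
-/

/-! ### Fourth moments of sums of independent variables -/

theorem enorm_pow_four_eq_ofReal (x : ℝ) : ‖x‖ₑ ^ 4 = ENNReal.ofReal (x ^ 4) := by
  rw [Real.enorm_eq_ofReal_abs, ← ENNReal.ofReal_pow (abs_nonneg x), (by decide : Even 4).pow_abs]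

theorem enorm_add_pow_four_le (a b : ℝ) : ‖a + b‖ₑ ^ 4 ≤ 8 * (‖a‖ₑ ^ 4 + ‖b‖ₑ ^ 4) := by
  simp only [enorm_pow_four_eq_ofReal]
  rw [← ENNReal.ofReal_add (by positivity) (by positivity),
    show (8 : ℝ≥0∞) = ENNReal.ofReal 8 by norm_num, ← ENNReal.ofReal_mul (by norm_num)]
  refine ENNReal.ofReal_le_ofReal ?_
  nlinarith [sq_nonneg (a ^ 2 - b ^ 2), sq_nonneg (a + b), sq_nonneg (a - b),
    sq_nonneg ((a - b) ^ 2), sq_nonneg (a * b), sq_nonneg (a ^ 2 + b ^ 2 - 2 * a * b)]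

theorem memLp_four_of_lintegral_lt_top {α E : Type*} [MeasurableSpace α] [NormedAddCommGroup E]
    {P : Measure α} {f : α → E} (hf : AEStronglyMeasurable f P) (h : ∫⁻ a, ‖f a‖ₑ ^ 4 ∂P < ∞) :
    MemLp f 4 P := by
  refine ⟨hf, ?_⟩
  rw [show (4 : ℝ≥0∞) = ((4 : ℝ≥0) : ℝ≥0∞) by norm_num,
    eLpNorm_lt_top_iff_lintegral_rpow_enorm_lt_top (by norm_num) (by norm_num)]
  simpa using h

theorem lintegral_enorm_pow_four_lt_top {α : Type*} [MeasurableSpace α] {P : Measure α}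
    {f : α → ℝ} (h : MemLp f 4 P) : ∫⁻ a, ‖f a‖ₑ ^ 4 ∂P < ∞ := by
  have := h.2
  rw [show (4 : ℝ≥0∞) = ((4 : ℝ≥0) : ℝ≥0∞) by norm_num,
    eLpNorm_lt_top_iff_lintegral_rpow_enorm_lt_top (by norm_num) (by norm_num)] at this
  simpa using this

theorem enorm_integral_pow_four_le {α : Type*} [MeasurableSpace α] (P : Measure α)
    [IsProbabilityMeasure P] {f : α → ℝ} (hf : Measurable f) :
    ‖∫ a, f a ∂P‖ₑ ^ 4 ≤ ∫⁻ a, ‖f a‖ₑ ^ 4 ∂P := by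
  have h1 : ‖∫ a, f a ∂P‖ₑ ≤ eLpNorm f ((4 : ℝ≥0) : ℝ≥0∞) P := by
    refine (enorm_integral_le_lintegral_enorm f).trans ?_
    rw [← eLpNorm_one_eq_lintegral_enorm]
    exact eLpNorm_le_eLpNorm_of_exponent_le (by norm_num) hf.aestronglyMeasurable
  have h2 := eLpNorm_nnreal_pow_eq_lintegral (f := f) (μ := P) (p := 4) (by norm_num)
  calc _ ≤ eLpNorm f ((4 : ℝ≥0) : ℝ≥0∞) P ^ 4 := by gcongr
    _ = _ := by simpa using h2

theorem MeasureTheory.MemLp.integrable_pow_of_le_four {α : Type*} [MeasurableSpace α]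
    {P : Measure α} [IsFiniteMeasure P] {f : α → ℝ} (hf : MemLp f 4 P) {k : ℕ} (hk : k ≤ 4) :
    Integrable (fun a => f a ^ k) P := by
  have h : MemLp f k P := hf.mono_exponent (by exact_mod_cast hk)
  refine (h.integrable_norm_pow').mono' (h.1.pow k) ?_
  filter_upwards with a
  simp

/-- The second moment of a sum of independent centred variables, together with the bound on its
fourth moment that results from expanding `(X i + S) ^ 4` and discarding the odd terms. The two are
proved together because the second moment of the partial sum enters the fourth. -/
theorem integral_sum_pow_four_le {ι Ω : Type*} [MeasurableSpace Ω] {P : Measure Ω}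
    [IsProbabilityMeasure P] {X : ι → Ω → ℝ} (hind : iIndepFun X P) (hm : ∀ i, Measurable (X i))
    (hX : ∀ i, MemLp (X i) 4 P) (h0 : ∀ i, ∫ ω, X i ω ∂P = 0) (s : Finset ι) :
    ∫ ω, (∑ i ∈ s, X i ω) ^ 2 ∂P = ∑ i ∈ s, ∫ ω, X i ω ^ 2 ∂P ∧
    ∫ ω, (∑ i ∈ s, X i ω) ^ 4 ∂P ≤
      3 * (∑ i ∈ s, ∫ ω, X i ω ^ 2 ∂P) ^ 2 + ∑ i ∈ s, ∫ ω, X i ω ^ 4 ∂P := by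
  classical
  induction s using Finset.induction_on with
  | empty => simp
  | insert i s hi ih =>
    obtain ⟨ih2, ih4⟩ := ih
    have hS : MemLp (fun ω => ∑ j ∈ s, X j ω) 4 P := memLp_finsetSum s fun j _ => hX j
    have hSm : Measurable fun ω => ∑ j ∈ s, X j ω := Finset.measurable_sum _ fun j _ => hm j
    have hI : IndepFun (X i) (fun ω => ∑ j ∈ s, X j ω) P := by
      have := (hind.indepFun_finsetSum_of_notMem hm hi).symm
      simpa [← Finset.sum_apply] using this
    generalize hSdef : (fun ω => ∑ j ∈ s, X j ω) = S at hS hSm hI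
    have hSω : ∀ ω, ∑ j ∈ s, X j ω = S ω := fun ω => congrFun hSdef ω
    simp only [Finset.sum_insert hi, hSω] at ih2 ih4 ⊢
    have hpow : ∀ a b : ℕ, a ≤ 4 → b ≤ 4 →
        Integrable (fun ω => X i ω ^ a * S ω ^ b) P ∧
        ∫ ω, X i ω ^ a * S ω ^ b ∂P = (∫ ω, X i ω ^ a ∂P) * ∫ ω, S ω ^ b ∂P := by
      intro a b ha hb
      have hI' : IndepFun (fun ω => X i ω ^ a) (fun ω => S ω ^ b) P :=
        hI.comp (measurable_id.pow_const a) (measurable_id.pow_const b)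
      exact ⟨hI'.integrable_mul ((hX i).integrable_pow_of_le_four ha)
        (hS.integrable_pow_of_le_four hb), hI'.integral_fun_mul_eq_mul_integral
        ((hm i).pow_const a).aestronglyMeasurable (hSm.pow_const b).aestronglyMeasurable⟩
    have hS0 : ∫ ω, S ω ∂P = 0 := by
      rw [← hSdef, integral_finsetSum _ fun j _ => (hX j).integrable (by norm_num)]
      simp [h0]
    have e2 : ∀ ω, (X i ω + S ω) ^ 2
        = X i ω ^ 2 + 2 * (X i ω ^ 1 * S ω ^ 1) + S ω ^ 2 := fun ω => by ring
    have e4 : ∀ ω, (X i ω + S ω) ^ 4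
        = X i ω ^ 4 + 4 * (X i ω ^ 3 * S ω ^ 1) + 6 * (X i ω ^ 2 * S ω ^ 2)
          + 4 * (X i ω ^ 1 * S ω ^ 3) + S ω ^ 4 := fun ω => by ring
    have hXk := fun k hk => (hX i).integrable_pow_of_le_four (k := k) hk
    have hSk := fun k hk => hS.integrable_pow_of_le_four (k := k) hk
    have p11 := hpow 1 1 (by norm_num) (by norm_num)
    have p31 := hpow 3 1 (by norm_num) (by norm_num)
    have p22 := hpow 2 2 (by norm_num) (by norm_num)
    have p13 := hpow 1 3 (by norm_num) (by norm_num)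
    have i2 : ∫ ω, (X i ω + S ω) ^ 2 ∂P = ∫ ω, X i ω ^ 2 ∂P + ∫ ω, S ω ^ 2 ∂P := by
      simp_rw [e2]
      have q11 : Integrable (fun ω => X i ω ^ 2 + 2 * (X i ω ^ 1 * S ω ^ 1)) P :=
        (hXk 2 (by norm_num)).add (p11.1.const_mul 2)
      rw [integral_add q11 (hSk 2 (by norm_num)),
        integral_add (hXk 2 (by norm_num)) (p11.1.const_mul 2), integral_const_mul, p11.2]
      simp [hS0]
    have i4 : ∫ ω, (X i ω + S ω) ^ 4 ∂P = ∫ ω, X i ω ^ 4 ∂P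
        + 6 * ((∫ ω, X i ω ^ 2 ∂P) * ∫ ω, S ω ^ 2 ∂P) + ∫ ω, S ω ^ 4 ∂P := by
      simp_rw [e4]
      have q4 := hXk 4 le_rfl
      have q31 := p31.1.const_mul 4
      have q22 := p22.1.const_mul 6
      have q13 := p13.1.const_mul 4
      have r1 : Integrable (fun ω => X i ω ^ 4 + 4 * (X i ω ^ 3 * S ω ^ 1)) P := q4.add q31
      have r2 : Integrable (fun ω => X i ω ^ 4 + 4 * (X i ω ^ 3 * S ω ^ 1)
        + 6 * (X i ω ^ 2 * S ω ^ 2)) P := r1.add q22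
      have r3 : Integrable (fun ω => X i ω ^ 4 + 4 * (X i ω ^ 3 * S ω ^ 1)
        + 6 * (X i ω ^ 2 * S ω ^ 2) + 4 * (X i ω ^ 1 * S ω ^ 3)) P := r2.add q13
      rw [integral_add r3 (hSk 4 le_rfl), integral_add r2 q13, integral_add r1 q22,
        integral_add q4 q31, integral_const_mul, integral_const_mul, integral_const_mul,
        p31.2, p22.2, p13.2]
      simp [hS0, h0 i]
    refine ⟨by rw [i2, ih2], ?_⟩
    rw [i4, ih2]
    nlinarith [sq_nonneg (∫ ω, X i ω ^ 2 ∂P)]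

theorem sq_integral_sq_le {Ω : Type*} [MeasurableSpace Ω] {P : Measure Ω} [IsProbabilityMeasure P]
    {X : Ω → ℝ} (hX : MemLp X 4 P) : (∫ ω, X ω ^ 2 ∂P) ^ 2 ≤ ∫ ω, X ω ^ 4 ∂P := by
  have h : Integrable (fun ω => (X ω ^ 2) ^ 2) P := by
    simpa only [← pow_mul] using hX.integrable_pow_of_le_four (k := 4) le_rfl
  have h2 : MemLp (fun ω => X ω ^ 2) 2 P :=
    (memLp_two_iff_integrable_sq (hX.1.pow 2)).2 h
  have hv := variance_nonneg (fun ω => X ω ^ 2) P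
  rw [variance_eq_sub h2] at hv
  simp only [Pi.pow_apply, ← pow_mul] at hv
  norm_num at hv
  exact hv

/-! ### Sums of independent particles -/

section ProductMeasure

variable {𝓧 : Type*} [MeasurableSpace 𝓧] {N : ℕ} (p : Fin N → Measure 𝓧)
  [∀ i, IsProbabilityMeasure (p i)]

theorem lintegral_pi_sum {h : 𝓧 → ℝ≥0∞} (hh : Measurable h) :
    ∫⁻ y, ∑ i, h (y i) ∂Measure.pi p = ∑ i, ∫⁻ z, h z ∂p i := by
  have hc : ∀ i : Fin N, Measurable fun y : Fin N → 𝓧 => h (y i) := fun i =>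
    hh.comp (measurable_pi_apply i)
  rw [lintegral_finsetSum _ fun i _ => hc i]
  exact Finset.sum_congr rfl fun i _ => (measurePreserving_eval p i).lintegral_comp hh

theorem lintegral_pi_prod {f : Fin N → 𝓧 → ℝ≥0∞} (hf : ∀ i, Measurable (f i)) :
    ∫⁻ y, ∏ i, f i (y i) ∂Measure.pi p = ∏ i, ∫⁻ z, f i z ∂p i := by
  have hind : iIndepFun (fun i (y : Fin N → 𝓧) => f i (y i)) (Measure.pi p) :=
    iIndepFun_pi fun i => (hf i).aemeasurable
  rw [lintegral_prod_eq_prod_lintegral_of_indepFun Finset.univ _ hind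
    fun i => (hf i).comp (measurable_pi_apply i)]
  exact Finset.prod_congr rfl fun i _ => (measurePreserving_eval p i).lintegral_comp (hf i)

/-- Fourth moment of a sum over independent particles with laws `p i`. Integrability is not assumed:
if some fourth moment is infinite, then so is the right-hand side, and the junk values of the
Bochner integrals do not matter. -/
theorem lintegral_pi_enorm_sum_pow_four_le {f : 𝓧 → ℝ} (hf : Measurable f) :
    ∫⁻ y, ‖∑ i, f (y i)‖ₑ ^ 4 ∂Measure.pi p ≤
      8 * ‖∑ i, ∫ z, f z ∂p i‖ₑ ^ 4 + 512 * N * ∑ i, ∫⁻ z, ‖f z‖ₑ ^ 4 ∂p i := by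
  rcases Nat.eq_zero_or_pos N with rfl | hN
  · simp
  by_cases htop : ∑ i, ∫⁻ z, ‖f z‖ₑ ^ 4 ∂p i = ∞
  · rw [htop, ENNReal.mul_top (by positivity)]
    simp
  have hfin : ∀ i, MemLp f 4 (p i) := fun i => memLp_four_of_lintegral_lt_top
    hf.aestronglyMeasurable
    ((ENNReal.sum_ne_top.1 htop i (Finset.mem_univ i)).lt_top)
  set m : Fin N → ℝ := fun i => ∫ z, f z ∂p i with hm
  set X : Fin N → (Fin N → 𝓧) → ℝ := fun i y => f (y i) - m i with hX
  have hXm : ∀ i, Measurable (X i) := fun i => (hf.comp (measurable_pi_apply i)).sub_const _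
  have hXp : ∀ i, MemLp (fun z => f z - m i) 4 (p i) := fun i => (hfin i).sub (memLp_const _)
  have hXL : ∀ i, MemLp (X i) 4 (Measure.pi p) := fun i =>
    (hXp i).comp_measurePreserving (measurePreserving_eval p i)
  have hint : ∀ i (g : 𝓧 → ℝ), Measurable g →
      ∫ y, g (y i) ∂Measure.pi p = ∫ z, g z ∂p i := fun i g hg => by
    rw [← (measurePreserving_eval p i).map_eq, integral_map (measurable_pi_apply i).aemeasurable
      hg.aestronglyMeasurable]
  have hX0 : ∀ i, ∫ y, X i y ∂Measure.pi p = 0 := fun i => by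
    rw [hint i (fun z => f z - m i) (hf.sub_const _),
      integral_sub ((hfin i).integrable (by norm_num)) (integrable_const _)]
    simp [hm]
  have hind : iIndepFun X (Measure.pi p) :=
    iIndepFun_pi (X := fun i z => f z - m i) fun i => (hf.sub_const _).aemeasurable
  have h4 := (integral_sum_pow_four_le hind hXm hXL hX0 Finset.univ).2
  have hsq : (∑ i, ∫ ω, X i ω ^ 2 ∂Measure.pi p) ^ 2 ≤
      N * ∑ i, ∫ ω, X i ω ^ 4 ∂Measure.pi p := by
    refine (sq_sum_le_card_mul_sum_sq).trans ?_
    rw [Finset.card_univ, Fintype.card_fin]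
    gcongr with i
    exact sq_integral_sq_le (hXL i)
  have hbound : ∫ y, (∑ i, X i y) ^ 4 ∂Measure.pi p ≤
      4 * N * ∑ i, ∫ y, X i y ^ 4 ∂Measure.pi p := by
    have hN1 : (1 : ℝ) ≤ N := by exact_mod_cast hN
    have hq : 0 ≤ ∑ i, ∫ y, X i y ^ 4 ∂Measure.pi p :=
      Finset.sum_nonneg fun i _ => integral_nonneg fun y => by positivity
    nlinarith
  have hoX : ∀ i, ENNReal.ofReal (∫ y, X i y ^ 4 ∂Measure.pi p) ≤
      16 * ∫⁻ z, ‖f z‖ₑ ^ 4 ∂p i := fun i => by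
    rw [hint i (fun z => (f z - m i) ^ 4) ((hf.sub_const _).pow_const 4),
      ofReal_integral_eq_lintegral_ofReal ((hXp i).integrable_pow_of_le_four le_rfl)
        (by filter_upwards with z using by positivity)]
    have hle : ∀ z, ENNReal.ofReal ((f z - m i) ^ 4) ≤ 8 * (‖f z‖ₑ ^ 4 + ‖m i‖ₑ ^ 4) := fun z => by
      rw [← enorm_pow_four_eq_ofReal, sub_eq_add_neg, ← enorm_neg (m i)]
      exact enorm_add_pow_four_le _ _
    calc _ ≤ ∫⁻ z, 8 * (‖f z‖ₑ ^ 4 + ‖m i‖ₑ ^ 4) ∂p i := lintegral_mono hle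
      _ = 8 * (∫⁻ z, ‖f z‖ₑ ^ 4 ∂p i + ‖m i‖ₑ ^ 4) := by
        rw [lintegral_const_mul _ (by fun_prop), lintegral_add_left (by fun_prop)]
        simp
      _ ≤ 8 * (∫⁻ z, ‖f z‖ₑ ^ 4 ∂p i + ∫⁻ z, ‖f z‖ₑ ^ 4 ∂p i) := by
        gcongr
        exact enorm_integral_pow_four_le (p i) hf
      _ = _ := by ring
  have hsumL : MemLp (fun y => ∑ i, X i y) 4 (Measure.pi p) :=
    memLp_finsetSum Finset.univ fun i _ => hXL i
  have hdev : ∫⁻ y, ‖∑ i, X i y‖ₑ ^ 4 ∂Measure.pi p ≤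
      64 * N * ∑ i, ∫⁻ z, ‖f z‖ₑ ^ 4 ∂p i := by
    simp only [enorm_pow_four_eq_ofReal (∑ i, X i _)]
    rw [← ofReal_integral_eq_lintegral_ofReal (hsumL.integrable_pow_of_le_four le_rfl)
        (by filter_upwards with z using by positivity)]
    refine (ENNReal.ofReal_le_ofReal hbound).trans ?_
    rw [ENNReal.ofReal_mul (by positivity), ENNReal.ofReal_mul (by positivity),
      ENNReal.ofReal_sum_of_nonneg fun i _ => integral_nonneg fun y => by positivity,
      ENNReal.ofReal_natCast]
    calc _ ≤ ENNReal.ofReal 4 * N * ∑ i, 16 * ∫⁻ z, ‖f z‖ₑ ^ 4 ∂p i := by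
          gcongr with i
          exact hoX i
      _ = _ := by
        rw [← Finset.mul_sum]
        norm_num
        ring
  have hle : ∀ y : Fin N → 𝓧, ‖∑ i, f (y i)‖ₑ ^ 4 ≤ 8 * (‖∑ i, m i‖ₑ ^ 4 + ‖∑ i, X i y‖ₑ ^ 4) := by
    intro y
    have e : ∑ i, f (y i) = ∑ i, m i + ∑ i, X i y := by
      rw [← Finset.sum_add_distrib]
      simp [hX]
    rw [e]
    exact enorm_add_pow_four_le _ _
  calc _ ≤ ∫⁻ y, 8 * (‖∑ i, m i‖ₑ ^ 4 + ‖∑ i, X i y‖ₑ ^ 4) ∂Measure.pi p := lintegral_mono hle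
    _ = 8 * (‖∑ i, m i‖ₑ ^ 4 + ∫⁻ y, ‖∑ i, X i y‖ₑ ^ 4 ∂Measure.pi p) := by
      rw [lintegral_const_mul _ (by fun_prop), lintegral_add_left (by fun_prop)]
      simp
    _ ≤ 8 * (‖∑ i, m i‖ₑ ^ 4 + 64 * N * ∑ i, ∫⁻ z, ‖f z‖ₑ ^ 4 ∂p i) := by gcongr
    _ = _ := by ring

theorem lintegral_exp_mul_le (q : Measure 𝓧) [IsProbabilityMeasure q] {g : 𝓧 → ℝ}
    (hg : Measurable g) {b l : ℝ} (hb : ∀ z, |g z| ≤ b) (hl : 0 ≤ l) (hlb : l * b ≤ 1) :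
    ∫⁻ z, ENNReal.ofReal (Real.exp (l * g z)) ∂q ≤
      ENNReal.ofReal (Real.exp (l * ∫ z, g z ∂q + l ^ 2 * b ^ 2)) := by
  have hgi : Integrable g q := Integrable.of_bound hg.aestronglyMeasurable b
    (by filter_upwards with z using hb z)
  have hpt : ∀ z, Real.exp (l * g z) ≤ 1 + l * g z + l ^ 2 * b ^ 2 := fun z => by
    have h1 : |l * g z| ≤ l * b := by
      rw [abs_mul, abs_of_nonneg hl]
      exact mul_le_mul_of_nonneg_left (hb z) hl
    have h2 := Real.norm_exp_sub_one_sub_id_le (x := l * g z) (h1.trans hlb)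
    have h3 := (abs_le.1 h2).2
    have h4 : ‖l * g z‖ ^ 2 ≤ (l * b) ^ 2 := by
      rw [Real.norm_eq_abs]
      gcongr
    nlinarith
  have hi : Integrable (fun z => 1 + l * g z + l ^ 2 * b ^ 2) q :=
    ((integrable_const _).add (hgi.const_mul l)).add (integrable_const _)
  calc _ ≤ ∫⁻ z, ENNReal.ofReal (1 + l * g z + l ^ 2 * b ^ 2) ∂q :=
        lintegral_mono fun z => ENNReal.ofReal_le_ofReal (hpt z)
    _ = ENNReal.ofReal (∫ z, (1 + l * g z + l ^ 2 * b ^ 2) ∂q) :=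
      (ofReal_integral_eq_lintegral_ofReal hi
        (by filter_upwards with z using (Real.exp_pos _).le.trans (hpt z))).symm
    _ ≤ _ := by
      refine ENNReal.ofReal_le_ofReal ?_
      have hi1 : Integrable (fun z => 1 + l * g z) q := (integrable_const _).add (hgi.const_mul l)
      rw [integral_add hi1 (integrable_const _),
        integral_add (integrable_const _) (hgi.const_mul l), integral_const_mul]
      simp only [integral_const, probReal_univ, one_smul]
      nlinarith [Real.add_one_le_exp (l * ∫ z, g z ∂q + l ^ 2 * b ^ 2)]

/-- A Chernoff bound that tolerates an unbounded weight `h`: if the mean of `∑ i, g (y i)` is at most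
`-N * ε`, then the event `0 ≤ ∑ i, g (y i)` carries an exponentially small share of the expectation of
`∑ i, h (y i)`. After bounding the indicator by an exponential, the integrand is a product over the
particles, and `h` occurs in one factor only. -/
theorem setLIntegral_pi_sum_le {g : 𝓧 → ℝ} (hg : Measurable g) {b ε : ℝ} (hb0 : 0 < b)
    (hb : ∀ z, |g z| ≤ b) (hε : 0 ≤ ε) (hεb : ε ≤ b) {h : 𝓧 → ℝ≥0∞} (hh : Measurable h)
    (hm : ∑ i, ∫ z, g z ∂p i ≤ -(N * ε)) :
    ∫⁻ y in {y | 0 ≤ ∑ i, g (y i)}, ∑ i, h (y i) ∂Measure.pi p ≤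
      ENNReal.ofReal (Real.exp 1 * Real.exp (-(ε ^ 2 / (4 * b ^ 2))) ^ N)
        * ∑ i, ∫⁻ z, h z ∂p i := by
  classical
  -- this rate maximizes the exponent `l * ε - l ^ 2 * b ^ 2`
  set l : ℝ := ε / (2 * b ^ 2) with hl
  have hl0 : 0 ≤ l := by positivity
  have hlb : l * b ≤ 1 / 2 := by
    rw [hl, div_mul_eq_mul_div, div_le_iff₀ (by positivity)]
    nlinarith
  have hS : MeasurableSet {y : Fin N → 𝓧 | 0 ≤ ∑ i, g (y i)} :=
    measurableSet_le measurable_const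
      (Finset.measurable_sum _ fun i _ => hg.comp (measurable_pi_apply i))
  have hc : ∀ i : Fin N, Measurable fun y : Fin N → 𝓧 => h (y i) := fun i =>
    hh.comp (measurable_pi_apply i)
  rw [lintegral_finsetSum _ fun i _ => hc i, Finset.mul_sum]
  refine Finset.sum_le_sum fun i _ => ?_
  let e : 𝓧 → ℝ≥0∞ := fun z => ENNReal.ofReal (Real.exp (l * g z))
  have he : Measurable e := by fun_prop
  let f : Fin N → 𝓧 → ℝ≥0∞ := fun j z => e z * if j = i then h z else 1
  have hf : ∀ j, Measurable (f j) := fun j => by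
    by_cases hj : j = i <;> simp only [f, hj, if_true, if_false] <;> fun_prop
  have hprod : ∀ y : Fin N → 𝓧, ∏ j, f j (y j)
      = ENNReal.ofReal (Real.exp (l * ∑ j, g (y j))) * h (y i) := fun y => by
    simp only [f, Finset.prod_mul_distrib]
    congr 1
    · simp only [e]
      rw [← ENNReal.ofReal_prod_of_nonneg fun j _ => (Real.exp_pos _).le, ← Real.exp_sum,
        Finset.mul_sum]
    · simp
  have h1 : ∫⁻ y in {y | 0 ≤ ∑ i, g (y i)}, h (y i) ∂Measure.pi p ≤
      ∫⁻ y, ∏ j, f j (y j) ∂Measure.pi p := by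
    rw [← lintegral_indicator hS]
    refine lintegral_mono fun y => Set.indicator_apply_le' (fun hy => ?_) fun _ => zero_le
    rw [hprod]
    refine le_mul_of_one_le_left zero_le ?_
    rw [← ENNReal.ofReal_one]
    exact ENNReal.ofReal_le_ofReal (Real.one_le_exp (mul_nonneg hl0 hy))
  refine h1.trans ?_
  rw [lintegral_pi_prod p hf, ← Finset.mul_prod_erase _ _ (Finset.mem_univ i)]
  have h2 : ∫⁻ z, f i z ∂p i ≤ ENNReal.ofReal (Real.exp (1 / 2)) * ∫⁻ z, h z ∂p i := by
    rw [← lintegral_const_mul _ hh]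
    refine lintegral_mono fun z => ?_
    simp only [f, e, if_true]
    gcongr
    exact (mul_le_mul_of_nonneg_left (le_of_abs_le (hb z)) hl0).trans hlb
  have h3 : ∏ j ∈ Finset.univ.erase i, ∫⁻ z, f j z ∂p j ≤
      ENNReal.ofReal (Real.exp (1 / 2) * Real.exp (-(ε ^ 2 / (4 * b ^ 2))) ^ N) := by
    calc _ ≤ ∏ j ∈ Finset.univ.erase i,
          ENNReal.ofReal (Real.exp (l * ∫ z, g z ∂p j + l ^ 2 * b ^ 2)) := by
          refine Finset.prod_le_prod' fun j hj => ?_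
          simp only [f, Finset.ne_of_mem_erase hj, if_false, mul_one]
          exact lintegral_exp_mul_le (p j) hg hb hl0 (by linarith)
      _ = ENNReal.ofReal (Real.exp (∑ j ∈ Finset.univ.erase i,
            (l * ∫ z, g z ∂p j + l ^ 2 * b ^ 2))) := by
          rw [← ENNReal.ofReal_prod_of_nonneg fun j _ => (Real.exp_pos _).le, ← Real.exp_sum]
      _ ≤ _ := by
          refine ENNReal.ofReal_le_ofReal ?_
          rw [← Real.exp_nat_mul, ← Real.exp_add]
          refine Real.exp_le_exp.2 ?_
          have h5 : ∑ j ∈ Finset.univ.erase i, (l * ∫ z, g z ∂p j + l ^ 2 * b ^ 2)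
              = ∑ j, (l * ∫ z, g z ∂p j + l ^ 2 * b ^ 2)
                - (l * ∫ z, g z ∂p i + l ^ 2 * b ^ 2) :=
            eq_sub_of_add_eq (Finset.sum_erase_add _ _ (Finset.mem_univ i))
          have h6 : |∫ z, g z ∂p i| ≤ b := by
            have := norm_integral_le_of_norm_le_const (μ := p i) (f := g) (C := b)
              (by filter_upwards with z using hb z)
            simpa using this
          have h7 : -(l * b) ≤ l * ∫ z, g z ∂p i := by
            have := mul_le_mul_of_nonneg_left (neg_le_of_abs_le h6) hl0
            linarith
          rw [h5, Finset.sum_add_distrib, ← Finset.mul_sum]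
          simp only [Finset.sum_const, Finset.card_univ, Fintype.card_fin, nsmul_eq_mul]
          have h8 := mul_le_mul_of_nonneg_left hm hl0
          have h9 : l * ε - l ^ 2 * b ^ 2 = ε ^ 2 / (4 * b ^ 2) := by
            rw [hl]
            field_simp
            ring
          rw [← h9]
          nlinarith [sq_nonneg (l * b)]
  calc _ ≤ (ENNReal.ofReal (Real.exp (1 / 2)) * ∫⁻ z, h z ∂p i) *
        ENNReal.ofReal (Real.exp (1 / 2) * Real.exp (-(ε ^ 2 / (4 * b ^ 2))) ^ N) :=
        mul_le_mul' h2 h3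
    _ = _ := by
      rw [mul_right_comm, ← ENNReal.ofReal_mul (by positivity), ← mul_assoc, ← Real.exp_add]
      norm_num

end ProductMeasure

/-! ### Sequences that decrease faster than every power -/

/-- The sequence `a` decreases faster than every negative power of its index. -/
def RapidlyDecreasing (a : ℕ → ℝ≥0∞) : Prop :=
  ∀ k : ℕ, ∃ C : ℝ≥0, ∀ N : ℕ, (N : ℝ≥0∞) ^ k * a N ≤ C

theorem RapidlyDecreasing.mono {a b : ℕ → ℝ≥0∞} (hb : RapidlyDecreasing b) (h : ∀ N, a N ≤ b N) :
    RapidlyDecreasing a := fun k => by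
  obtain ⟨C, hC⟩ := hb k
  exact ⟨C, fun N => (mul_le_mul_right (h N) _).trans (hC N)⟩

theorem RapidlyDecreasing.add {a b : ℕ → ℝ≥0∞} (ha : RapidlyDecreasing a)
    (hb : RapidlyDecreasing b) : RapidlyDecreasing fun N => a N + b N := fun k => by
  obtain ⟨C, hC⟩ := ha k
  obtain ⟨D, hD⟩ := hb k
  refine ⟨C + D, fun N => ?_⟩
  rw [mul_add, ENNReal.coe_add]
  exact add_le_add (hC N) (hD N)

theorem RapidlyDecreasing.natCast_mul {a : ℕ → ℝ≥0∞} (ha : RapidlyDecreasing a) :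
    RapidlyDecreasing fun N => N * a N := fun k => by
  obtain ⟨C, hC⟩ := ha (k + 1)
  refine ⟨C, fun N => ?_⟩
  rw [← mul_assoc, ← pow_succ]
  exact hC N

theorem RapidlyDecreasing.mul_const {a : ℕ → ℝ≥0∞} (ha : RapidlyDecreasing a) (D : ℝ≥0) :
    RapidlyDecreasing fun N => a N * D := fun k => by
  obtain ⟨C, hC⟩ := ha k
  refine ⟨C * D, fun N => ?_⟩
  rw [← mul_assoc, ENNReal.coe_mul]
  exact mul_le_mul_left (hC N) _

theorem rapidlyDecreasing_geometric (c : ℝ) {r : ℝ} (hc : 0 ≤ c) (hr0 : 0 ≤ r) (hr : r < 1) :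
    RapidlyDecreasing fun N => ENNReal.ofReal (c * r ^ N) := fun k => by
  obtain ⟨B, hB⟩ := (tendsto_pow_const_mul_const_pow_of_abs_lt_one k
    (by rwa [abs_of_nonneg hr0])).bddAbove_range
  refine ⟨(c * B).toNNReal, fun N => ?_⟩
  have h := hB (Set.mem_range_self N)
  rw [← ENNReal.ofReal_natCast, ← ENNReal.ofReal_pow (by positivity),
    ← ENNReal.ofReal_mul (by positivity)]
  refine ENNReal.ofReal_le_ofReal ?_
  calc _ = c * ((N : ℝ) ^ k * r ^ N) := by ring
    _ ≤ _ := mul_le_mul_of_nonneg_left h hc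

theorem MeasureTheory.Measure.integral_bind_kernel {α β : Type*} [MeasurableSpace α]
    [MeasurableSpace β] {μ : Measure α} {κ : Kernel α β} {f : β → ℝ}
    (hf : Integrable f (μ.bind κ)) : ∫ z, f z ∂(μ.bind κ) = ∫ x, ∫ z, f z ∂κ x ∂μ := by
  rw [Measure.comp_eq_comp_const_apply] at hf ⊢
  rw [Kernel.integral_comp hf, Kernel.const_apply]

/-! ### Controlled clouds: sampling and propagation -/

section Controlled

variable {𝓧 : Type*} [MeasurableSpace 𝓧]

/-- The conditional law of the `i`-th particle of a cloud of size `N`, given a background state with law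
`Q N`, is `p N i`; for a cloud that is itself the background state, `p` is `particle`. The structure
says that these random measures approximate the target `μ`, with error bounds for functions whose
integrability is expressed through the reference measure `ν`. All bounds are for sums over the
particles, not for averages.

The field `deviation` says that an event on which a bounded function of negative mean has a
nonnegative sum over the particles is negligible, even when weighted with the sum of an unbounded
integrable function `h`. It is what controls small normalizers of the importance weights. -/
structure IsControlled (Q : ∀ N, Measure (Fin N → 𝓧)) (p : ∀ N, Fin N → Kernel (Fin N → 𝓧) 𝓧)
    (μ ν : Measure 𝓧) : Prop where
  prob : IsProbabilityMeasure μ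
  prob_ref : IsProbabilityMeasure ν
  dominated : ∃ C : ℝ≥0, ∀ h : 𝓧 → ℝ≥0∞, Measurable h → ∫⁻ z, h z ∂μ ≤ C * ∫⁻ z, h z ∂ν
  moment : ∀ h : 𝓧 → ℝ≥0∞, Measurable h → ∫⁻ z, h z ∂ν < ∞ →
    ∃ C : ℝ≥0, ∀ N, ∫⁻ x, ∑ i, ∫⁻ z, h z ∂p N i x ∂Q N ≤ C * N
  deviation : ∀ h : 𝓧 → ℝ≥0∞, Measurable h → ∫⁻ z, h z ∂ν < ∞ →
    ∀ g : 𝓧 → ℝ, Measurable g → (∃ b, ∀ z, |g z| ≤ b) → ∫ z, g z ∂μ < 0 →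
    RapidlyDecreasing fun N =>
      ∫⁻ x in {x | 0 ≤ ∑ i, ∫ z, g z ∂p N i x}, ∑ i, ∫⁻ z, h z ∂p N i x ∂Q N
  fourth : ∀ f : 𝓧 → ℝ, Measurable f → ∫⁻ z, ‖f z‖ₑ ^ 4 ∂ν < ∞ → ∫ z, f z ∂μ = 0 →
    ∃ C : ℝ≥0, ∀ N, ∫⁻ x, ‖∑ i, ∫ z, f z ∂p N i x‖ₑ ^ 4 ∂Q N ≤ C * N ^ 2

/-- The kernel that reads off the `i`-th particle of a cloud: the unit mass at that particle. -/
noncomputable def particle (N : ℕ) (i : Fin N) : Kernel (Fin N → 𝓧) 𝓧 :=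
  Kernel.deterministic (fun x => x i) (measurable_pi_apply i)

theorem lintegral_particle {N : ℕ} (i : Fin N) (x : Fin N → 𝓧) {h : 𝓧 → ℝ≥0∞}
    (hh : Measurable h) : ∫⁻ z, h z ∂particle N i x = h (x i) := by
  rw [particle, Kernel.deterministic_apply, lintegral_dirac' _ hh]

theorem integral_particle {N : ℕ} (i : Fin N) (x : Fin N → 𝓧) {f : 𝓧 → ℝ}
    (hf : Measurable f) : ∫ z, f z ∂particle N i x = f (x i) := by
  rw [particle, Kernel.deterministic_apply, integral_dirac' _ _ hf.stronglyMeasurable]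

theorem measurableSet_sum_integral_nonneg {N : ℕ} (p : Fin N → Kernel (Fin N → 𝓧) 𝓧) {g : 𝓧 → ℝ}
    (hg : Measurable g) : MeasurableSet {x | 0 ≤ ∑ i, ∫ z, g z ∂p i x} :=
  measurableSet_le measurable_const (Finset.measurable_sum _ fun _ _ =>
    hg.stronglyMeasurable.integral_kernel.measurable)

namespace IsControlled

variable {Q : ∀ N, Measure (Fin N → 𝓧)} {p : ∀ N, Fin N → Kernel (Fin N → 𝓧) 𝓧} {μ ν : Measure 𝓧}

theorem lintegral_lt_top (hc : IsControlled Q p μ ν) {h : 𝓧 → ℝ≥0∞} (hh : Measurable h)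
    (hν : ∫⁻ z, h z ∂ν < ∞) : ∫⁻ z, h z ∂μ < ∞ := by
  obtain ⟨C, hC⟩ := hc.dominated
  exact (hC h hh).trans_lt (ENNReal.mul_lt_top ENNReal.coe_lt_top hν)

theorem integrable (hc : IsControlled Q p μ ν) {f : 𝓧 → ℝ} (hf : Measurable f)
    (hν : ∫⁻ z, ‖f z‖ₑ ^ 4 ∂ν < ∞) : Integrable f μ :=
  have := hc.prob
  (memLp_four_of_lintegral_lt_top hf.aestronglyMeasurable
    (hc.lintegral_lt_top (by fun_prop) hν)).integrable (by norm_num)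

/-- Drawing the particles independently from their conditional laws preserves the bounds. -/
theorem sampling (hc : IsControlled Q p μ ν) (hp : ∀ N i x, IsProbabilityMeasure (p N i x))
    (K : ∀ N, Kernel (Fin N → 𝓧) (Fin N → 𝓧))
    (hK : ∀ N x, K N x = Measure.pi fun i => p N i x) :
    IsControlled (fun N => (Q N).bind (K N)) particle μ ν where
  prob := hc.prob
  prob_ref := hc.prob_ref
  dominated := hc.dominated
  moment h hh hν := by
    obtain ⟨C, hC⟩ := hc.moment h hh hν
    refine ⟨C, fun N => ?_⟩
    simp only [lintegral_particle _ _ hh]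
    have hsum : Measurable fun y : Fin N → 𝓧 => ∑ i, h (y i) :=
      Finset.measurable_sum _ fun i _ => hh.comp (measurable_pi_apply i)
    rw [Measure.lintegral_bind (K N).measurable.aemeasurable hsum.aemeasurable]
    simp only [hK, lintegral_pi_sum _ hh]
    exact hC N
  deviation h hh hν g hg hgb hneg := by
    have := hc.prob
    obtain ⟨b₀, hb₀⟩ := hgb
    set b := max b₀ 1 with hbdef
    have hb : ∀ z, |g z| ≤ b := fun z => (hb₀ z).trans (le_max_left _ _)
    have hb0 : 0 < b := lt_max_of_lt_right one_pos
    have hgi : ∀ (q : Measure 𝓧) [IsFiniteMeasure q], Integrable g q := fun q _ =>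
      Integrable.of_bound hg.aestronglyMeasurable b (by filter_upwards with z using hb z)
    set ε := -(∫ z, g z ∂μ) / 2 with hε
    have hε0 : 0 < ε := by linarith
    have hεb : ε ≤ b := by
      have := norm_integral_le_of_norm_le_const (μ := μ) (f := g) (C := b)
        (by filter_upwards with z using hb z)
      have h2 : |∫ z, g z ∂μ| ≤ b := by simpa using this
      have := neg_le_of_abs_le h2
      linarith
    have hshift : ∀ (q : Measure 𝓧) [IsProbabilityMeasure q],
        ∫ z, (g z + ε) ∂q = ∫ z, g z ∂q + ε := fun q _ => by
      rw [integral_add (hgi q) (integrable_const _)]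
      simp
    have hdev := hc.deviation h hh hν (fun z => g z + ε) (hg.add_const _)
      ⟨b + ε, fun z => (abs_add_le _ _).trans
        (add_le_add (hb z) (abs_of_pos hε0).le)⟩ (by rw [hshift]; linarith)
    obtain ⟨C, hC⟩ := hc.moment h hh hν
    set r := Real.exp (-(ε ^ 2 / (4 * b ^ 2))) with hr
    have hgeo := (rapidlyDecreasing_geometric (Real.exp 1) (r := r) (Real.exp_pos _).le
      (Real.exp_pos _).le (Real.exp_lt_one_iff.2 (by rw [neg_lt_zero]; positivity)))
    refine (hdev.add (hgeo.mul_const C).natCast_mul).mono fun N => ?_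
    simp only [lintegral_particle _ _ hh, integral_particle _ _ hg]
    have hS : MeasurableSet {y : Fin N → 𝓧 | 0 ≤ ∑ i, g (y i)} :=
      measurableSet_le measurable_const
        (Finset.measurable_sum _ fun i _ => hg.comp (measurable_pi_apply i))
    have hsum : Measurable fun y : Fin N → 𝓧 => ∑ i, h (y i) :=
      Finset.measurable_sum _ fun i _ => hh.comp (measurable_pi_apply i)
    have hpsum : Measurable fun x => ∑ i, ∫⁻ z, h z ∂p N i x :=
      Finset.measurable_sum _ fun i _ => hh.lintegral_kernel
    rw [← lintegral_indicator hS, Measure.lintegral_bind (K N).measurable.aemeasurable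
      (hsum.indicator hS).aemeasurable]
    have hpt : ∀ x, ∫⁻ y, ({y : Fin N → 𝓧 | 0 ≤ ∑ i, g (y i)}.indicator
          fun y => ∑ i, h (y i)) y ∂K N x ≤
        ({x | 0 ≤ ∑ i, ∫ z, (g z + ε) ∂p N i x}.indicator
          fun x => ∑ i, ∫⁻ z, h z ∂p N i x) x
        + ENNReal.ofReal (Real.exp 1 * r ^ N) * ∑ i, ∫⁻ z, h z ∂p N i x := fun x => by
      have := hp N
      rw [hK, lintegral_indicator hS]
      have e : ∑ i, ∫ z, (g z + ε) ∂p N i x = ∑ i, ∫ z, g z ∂p N i x + N * ε := by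
        simp [hshift, Finset.sum_add_distrib]
      by_cases hx : 0 ≤ ∑ i, ∫ z, (g z + ε) ∂p N i x
      · rw [Set.indicator_of_mem (show x ∈ {x | 0 ≤ ∑ i, ∫ z, (g z + ε) ∂p N i x} from hx)]
        refine le_add_right ((setLIntegral_le_lintegral _ _).trans ?_)
        rw [lintegral_pi_sum _ hh]
      · refine le_add_left (setLIntegral_pi_sum_le _ hg hb0 hb hε0.le hεb hh ?_)
        rw [e] at hx
        linarith
    refine (lintegral_mono hpt).trans ?_
    rw [lintegral_add_right _ (hpsum.const_mul _), lintegral_const_mul _ hpsum,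
      lintegral_indicator (measurableSet_sum_integral_nonneg _ (hg.add_const _))]
    refine add_le_add le_rfl ?_
    refine (mul_le_mul_right (hC N) _).trans (le_of_eq ?_)
    ring
  fourth f hf hν h0 := by
    obtain ⟨C, hC⟩ := hc.fourth f hf hν h0
    obtain ⟨D, hD⟩ := hc.moment (fun z => ‖f z‖ₑ ^ 4) (by fun_prop) hν
    refine ⟨8 * C + 512 * D, fun N => ?_⟩
    have hfsum : Measurable fun y : Fin N → 𝓧 => ∑ i, f (y i) :=
      Finset.measurable_sum _ fun i _ => hf.comp (measurable_pi_apply i)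
    simp only [integral_particle _ _ hf]
    rw [Measure.lintegral_bind (K N).measurable.aemeasurable
      (hfsum.enorm.pow_const 4).aemeasurable]
    have := hp N
    have hpsum : Measurable fun x => ∑ i, ∫⁻ z, ‖f z‖ₑ ^ 4 ∂p N i x :=
      Finset.measurable_sum _ fun i _ => Measurable.lintegral_kernel (by fun_prop)
    have hpint : Measurable fun x => ∑ i, ∫ z, f z ∂p N i x :=
      Finset.measurable_sum _ fun i _ => hf.stronglyMeasurable.integral_kernel.measurable
    calc _ ≤ ∫⁻ x, (8 * ‖∑ i, ∫ z, f z ∂p N i x‖ₑ ^ 4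
            + 512 * N * ∑ i, ∫⁻ z, ‖f z‖ₑ ^ 4 ∂p N i x) ∂Q N := by
          refine lintegral_mono fun x => ?_
          rw [hK]
          exact lintegral_pi_enorm_sum_pow_four_le _ hf
      _ = 8 * ∫⁻ x, ‖∑ i, ∫ z, f z ∂p N i x‖ₑ ^ 4 ∂Q N
            + 512 * N * ∫⁻ x, ∑ i, ∫⁻ z, ‖f z‖ₑ ^ 4 ∂p N i x ∂Q N := by
          rw [lintegral_add_right _ (hpsum.const_mul _), lintegral_const_mul _ hpsum,
            lintegral_const_mul _ (by fun_prop)]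
      _ ≤ 8 * (C * N ^ 2) + 512 * N * (D * N) := by
          gcongr
          · exact hC N
          · exact hD N
      _ = _ := by
          push_cast
          ring

/-- Moving the particles of a cloud with a Markov kernel, before the new positions are drawn, preserves
the bounds: the test functions are replaced by their averages under the kernel. -/
theorem propagation (hc : IsControlled Q particle μ ν) (κ : Kernel 𝓧 𝓧) [IsMarkovKernel κ] :
    IsControlled Q (fun N i => κ.comap (fun x : Fin N → 𝓧 => x i) (measurable_pi_apply i))
      (μ.bind κ) (ν.bind κ) where
  prob := by
    have := hc.prob
    infer_instance
  prob_ref := by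
    have := hc.prob_ref
    infer_instance
  dominated := by
    obtain ⟨C, hC⟩ := hc.dominated
    refine ⟨C, fun h hh => ?_⟩
    rw [Measure.lintegral_bind κ.measurable.aemeasurable hh.aemeasurable,
      Measure.lintegral_bind κ.measurable.aemeasurable hh.aemeasurable]
    exact hC _ hh.lintegral_kernel
  moment h hh hν := by
    rw [Measure.lintegral_bind κ.measurable.aemeasurable hh.aemeasurable] at hν
    simpa only [lintegral_particle _ _ hh.lintegral_kernel, Kernel.comap_apply]
      using hc.moment _ hh.lintegral_kernel hν
  deviation h hh hν g hg hgb hneg := by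
    have := hc.prob
    obtain ⟨b, hb⟩ := hgb
    have hgm : Measurable fun x => ∫ z, g z ∂κ x :=
      hg.stronglyMeasurable.integral_kernel.measurable
    rw [Measure.lintegral_bind κ.measurable.aemeasurable hh.aemeasurable] at hν
    rw [Measure.integral_bind_kernel (Integrable.of_bound hg.aestronglyMeasurable b
      (by filter_upwards with z using hb z))] at hneg
    simpa only [lintegral_particle _ _ hh.lintegral_kernel, Kernel.comap_apply,
      integral_particle _ _ hgm] using hc.deviation _ hh.lintegral_kernel hν _ hgm
        ⟨b, fun x => by
          have := norm_integral_le_of_norm_le_const (μ := κ x) (f := g) (C := b)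
            (by filter_upwards with z using hb z)
          simpa using this⟩ hneg
  fourth f hf hν h0 := by
    have := hc.prob
    have hfm : Measurable fun x => ∫ z, f z ∂κ x :=
      hf.stronglyMeasurable.integral_kernel.measurable
    have hhm : Measurable fun z => ‖f z‖ₑ ^ 4 := by fun_prop
    rw [Measure.lintegral_bind κ.measurable.aemeasurable hhm.aemeasurable] at hν
    have hμ : ∫⁻ z, ‖f z‖ₑ ^ 4 ∂(μ.bind κ) < ∞ := by
      rw [Measure.lintegral_bind κ.measurable.aemeasurable hhm.aemeasurable]
      exact hc.lintegral_lt_top hhm.lintegral_kernel hν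
    rw [Measure.integral_bind_kernel ((memLp_four_of_lintegral_lt_top hf.aestronglyMeasurable
      hμ).integrable (by norm_num))] at h0
    simpa only [Kernel.comap_apply, integral_particle _ _ hfm] using hc.fourth _ hfm
      ((lintegral_mono fun x => enorm_integral_pow_four_le (κ x) hf).trans_lt hν) h0

end IsControlled

end Controlled

/-! ### Importance weights and Bayes' rule -/

section Weights

variable {𝓧 : Type*} {N : ℕ}

theorem normWeight_le_one (g : 𝓧 → ℝ≥0) (x : Fin N → 𝓧) (i : Fin N) : normWeight g x i ≤ 1 := by
  unfold normWeight
  split_ifs with h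
  · have : 1 ≤ N := i.pos
    exact inv_le_one_of_one_le₀ (by exact_mod_cast this)
  · exact div_le_one_of_le₀ (Finset.single_le_sum (f := fun j => g (x j)) (fun _ _ => zero_le)
      (Finset.mem_univ i)) zero_le

theorem sum_normWeight (g : 𝓧 → ℝ≥0) (x : Fin N → 𝓧) (hN : N ≠ 0) :
    ∑ i, normWeight g x i = 1 := by
  unfold normWeight
  split_ifs with h
  · simp [hN]
  · rw [← Finset.sum_div, div_self h]

/-- If the normalizer exceeds half of its limit `N * z`, then each weight is of order `1 / N`. -/
theorem natCast_mul_normWeight_le {g : 𝓧 → ℝ≥0} {b z : ℝ≥0} (hb : ∀ u, g u ≤ b) (hz : 0 < z)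
    {x : Fin N → 𝓧} (hx : ∑ i, ((z : ℝ) / 2 - g (x i)) < 0) (i : Fin N) :
    N * normWeight g x i ≤ 2 / z * b := by
  have hS : (N : ℝ) * (z / 2) < ∑ j, (g (x j) : ℝ) := by
    simpa [Finset.sum_sub_distrib] using hx
  have hS' : (N : ℝ≥0) * (z / 2) < ∑ j, g (x j) := by
    rw [← NNReal.coe_lt_coe]
    push_cast
    exact hS
  have hpos : 0 < ∑ j, g (x j) := zero_le.trans_lt hS'
  rw [normWeight, if_neg hpos.ne', ← mul_div_assoc, div_le_iff₀ hpos]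
  calc (N : ℝ≥0) * g (x i) ≤ N * b := by gcongr; exact hb _
    _ = 2 / z * b * (N * (z / 2)) := by field_simp
    _ ≤ _ := by gcongr

variable [MeasurableSpace 𝓧]

theorem lintegral_particleMeasure (g : 𝓧 → ℝ≥0) (x : Fin N → 𝓧) {h : 𝓧 → ℝ≥0∞}
    (hh : Measurable h) :
    ∫⁻ z, h z ∂particleMeasure g x = ∑ i, (normWeight g x i : ℝ≥0∞) * h (x i) := by
  simp only [particleMeasure, lintegral_finsetSum_measure, lintegral_smul_measure,
    lintegral_dirac' _ hh, smul_eq_mul]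

theorem integral_particleMeasure (g : 𝓧 → ℝ≥0) (x : Fin N → 𝓧) {f : 𝓧 → ℝ}
    (hf : Measurable f) :
    Integrable f (particleMeasure g x) ∧
    ∫ z, f z ∂particleMeasure g x = ∑ i, (normWeight g x i : ℝ) * f (x i) := by
  have hd : ∀ i, Integrable f ((normWeight g x i : ℝ≥0∞) • Measure.dirac (x i)) := fun i => by
    refine Integrable.smul_measure ⟨hf.aestronglyMeasurable, ?_⟩ ENNReal.coe_ne_top
    rw [HasFiniteIntegral, lintegral_dirac' _ (by fun_prop)]
    exact enorm_lt_top
  refine ⟨integrable_finsetSum_measure.2 fun i _ => hd i, ?_⟩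
  rw [particleMeasure, integral_finsetSum_measure fun i _ => hd i]
  refine Finset.sum_congr rfl fun i _ => ?_
  rw [integral_smul_measure, integral_dirac' _ _ hf.stronglyMeasurable]
  simp

theorem isProbabilityMeasure_particleMeasure (g : 𝓧 → ℝ≥0) (x : Fin N → 𝓧) (hN : N ≠ 0) :
    IsProbabilityMeasure (particleMeasure g x) := by
  refine ⟨?_⟩
  rw [← lintegral_one, lintegral_particleMeasure g x measurable_const]
  simp only [mul_one]
  rw [← ENNReal.ofNNReal_finsetSum, sum_normWeight g x hN, ENNReal.coe_one]

theorem lintegral_bayesUpdate {g : 𝓧 → ℝ≥0} (hg : Measurable g) (μ : Measure 𝓧) {h : 𝓧 → ℝ≥0∞}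
    (hh : Measurable h) :
    ∫⁻ z, h z ∂bayesUpdate g μ = (∫⁻ z, g z ∂μ)⁻¹ * ∫⁻ z, g z * h z ∂μ := by
  rw [bayesUpdate, lintegral_smul_measure, lintegral_withDensity_eq_lintegral_mul _ (by fun_prop) hh]
  rfl

theorem integral_bayesUpdate {g : 𝓧 → ℝ≥0} (hg : Measurable g) (μ : Measure 𝓧) (f : 𝓧 → ℝ) :
    ∫ z, f z ∂bayesUpdate g μ = ((∫⁻ z, g z ∂μ)⁻¹).toReal * ∫ z, g z * f z ∂μ := by
  rw [bayesUpdate, integral_smul_measure, integral_withDensity_eq_integral_smul hg]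
  rfl

/-- The weighted particle measure as a kernel from clouds to measures on the state space. -/
noncomputable def weightedParticles (g : 𝓧 → ℝ≥0) (hg : Measurable g) (N : ℕ) :
    Kernel (Fin N → 𝓧) 𝓧 where
  toFun x := particleMeasure g x
  measurable' := measurable_particleMeasure hg

theorem weightedParticles_apply (g : 𝓧 → ℝ≥0) (hg : Measurable g) (N : ℕ) (x : Fin N → 𝓧) :
    weightedParticles g hg N x = particleMeasure g x := rfl

theorem lintegral_particleMeasure_le (g : 𝓧 → ℝ≥0) (x : Fin N → 𝓧) {h : 𝓧 → ℝ≥0∞}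
    (hh : Measurable h) : ∫⁻ z, h z ∂particleMeasure g x ≤ ∑ i, h (x i) := by
  rw [lintegral_particleMeasure g x hh]
  refine Finset.sum_le_sum fun i _ => mul_le_of_le_one_left zero_le ?_
  exact_mod_cast normWeight_le_one g x i

/-- If the normalizer exceeds half of its limit `N * z`, then the weighted estimate is bounded by the
unnormalized sum. -/
theorem abs_natCast_mul_integral_particleMeasure_le {g : 𝓧 → ℝ≥0} {z : ℝ≥0} (hz : 0 < z)
    {x : Fin N → 𝓧} (hx : ∑ i, ((z : ℝ) / 2 - g (x i)) < 0) {f : 𝓧 → ℝ} (hf : Measurable f) :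
    |N * ∫ u, f u ∂particleMeasure g x| ≤ 2 / z * |∑ i, g (x i) * f (x i)| := by
  have hz' : (0 : ℝ) < z := hz
  have hS : (N : ℝ) * (z / 2) < ∑ j, (g (x j) : ℝ) := by
    simpa [Finset.sum_sub_distrib] using hx
  have hpos : 0 < ∑ j, (g (x j) : ℝ) := lt_of_le_of_lt (by positivity) hS
  have hne : ∑ j, g (x j) ≠ 0 := fun h0 => hpos.ne' (by exact_mod_cast congrArg NNReal.toReal h0)
  have e : ∫ u, f u ∂particleMeasure g x = (∑ i, g (x i) * f (x i)) / ∑ j, (g (x j) : ℝ) := by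
    rw [(integral_particleMeasure g x hf).2, Finset.sum_div]
    refine Finset.sum_congr rfl fun i _ => ?_
    rw [normWeight, if_neg hne]
    push_cast
    ring
  rw [e, abs_mul, abs_div, abs_of_pos hpos, Nat.abs_cast, ← mul_div_assoc, div_le_iff₀ hpos]
  have h2 : (N : ℝ) ≤ 2 / z * ∑ j, (g (x j) : ℝ) := by
    rw [div_mul_eq_mul_div, le_div_iff₀ hz']
    linarith
  calc _ ≤ (2 / z * ∑ j, (g (x j) : ℝ)) * |∑ i, g (x i) * f (x i)| := by gcongr
    _ = _ := by ring

end Weights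

/-! ### Controlled clouds: reweighting and initialization -/

namespace IsControlled

variable {𝓧 : Type*} [MeasurableSpace 𝓧] {Q : ∀ N, Measure (Fin N → 𝓧)} {μ ν : Measure 𝓧}

/-- Reweighting a cloud with a bounded likelihood whose limiting normalizer does not vanish preserves
the bounds. The reference measure need not change, because the updated target is at most a multiple
of the old one. -/
theorem reweighting (hc : IsControlled Q particle μ ν) {g : 𝓧 → ℝ≥0} (hg : Measurable g)
    {b : ℝ≥0} (hb : ∀ u, g u ≤ b) (hZ : ∫⁻ u, g u ∂μ ≠ 0) :
    IsControlled Q (fun N _ => weightedParticles g hg N) (bayesUpdate g μ) ν := by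
  have := hc.prob
  have := hc.prob_ref
  have hgR : Measurable fun u => (g u : ℝ) := by fun_prop
  have hZtop : ∫⁻ u, g u ∂μ ≠ ∞ := by
    refine ((lintegral_mono fun u => ENNReal.coe_le_coe.2 (hb u)).trans_lt ?_).ne
    simp
  obtain ⟨z, hz⟩ : ∃ z : ℝ≥0, ∫⁻ u, g u ∂μ = z := ⟨_, (ENNReal.coe_toNNReal hZtop).symm⟩
  have hz0 : 0 < z := by
    rw [pos_iff_ne_zero]
    rintro rfl
    simp [hz] at hZ
  have hgz : ∫ u, (g u : ℝ) ∂μ = z := by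
    rw [integral_eq_lintegral_of_nonneg_ae (by filter_upwards with u using NNReal.coe_nonneg _)
      hgR.aestronglyMeasurable]
    simp [hz]
  have hgi : Integrable (fun u => (g u : ℝ)) μ :=
    Integrable.of_bound hgR.aestronglyMeasurable b (by filter_upwards with u; simpa using hb u)
  have hinv : 0 < ((∫⁻ u, g u ∂μ)⁻¹).toReal := by
    rw [hz]
    simpa using hz0
  -- the event that the normalizer is at most half its limit is negligible
  have hbadm : Measurable fun u => (z : ℝ) / 2 - g u := by fun_prop
  have hbad : ∀ h : 𝓧 → ℝ≥0∞, Measurable h → ∫⁻ u, h u ∂ν < ∞ → RapidlyDecreasing fun N =>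
      ∫⁻ x in {x : Fin N → 𝓧 | 0 ≤ ∑ i, ((z : ℝ) / 2 - g (x i))}, ∑ i, h (x i) ∂Q N :=
    fun h hh hν => by
    have hd := hc.deviation h hh hν (fun u => z / 2 - g u) hbadm
      ⟨z / 2 + b, fun u => (abs_sub _ _).trans
        (add_le_add (abs_of_nonneg (by positivity)).le (by simpa using hb u))⟩ (by
        rw [integral_sub (integrable_const _) hgi, hgz]
        simp
        linarith)
    simpa only [lintegral_particle _ _ hh, integral_particle _ _ hbadm] using hd
  have hSet : ∀ N, MeasurableSet {x : Fin N → 𝓧 | 0 ≤ ∑ i, ((z : ℝ) / 2 - g (x i))} := fun N =>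
    measurableSet_le measurable_const
      (Finset.measurable_sum _ fun i _ => hbadm.comp (measurable_pi_apply i))
  refine ⟨⟨?_⟩, hc.prob_ref, ?_, fun h hh hν => ?_, fun h hh hν f hf hfb hneg => ?_,
    fun f hf hν h0 => ?_⟩
  · rw [← lintegral_one, lintegral_bayesUpdate hg μ measurable_const]
    simp only [mul_one]
    exact ENNReal.inv_mul_cancel hZ hZtop
  · obtain ⟨C, hC⟩ := hc.dominated
    refine ⟨z⁻¹ * (b * C), fun h hh => ?_⟩
    rw [lintegral_bayesUpdate hg μ hh, hz, ← ENNReal.coe_inv hz0.ne', ENNReal.coe_mul,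
      ENNReal.coe_mul, mul_assoc, mul_assoc]
    gcongr
    calc _ ≤ ∫⁻ u, b * h u ∂μ := lintegral_mono fun u => by gcongr; exact hb u
      _ = b * ∫⁻ u, h u ∂μ := lintegral_const_mul _ hh
      _ ≤ _ := by
        gcongr
        exact hC h hh
  · obtain ⟨C, hC⟩ := hc.moment h hh hν
    obtain ⟨D, hD⟩ := hbad h hh hν 0
    simp only [lintegral_particle _ _ hh] at hC
    refine ⟨2 / z * b * C + D, fun N => ?_⟩
    have hsum : Measurable fun y : Fin N → 𝓧 => ∑ i, h (y i) :=
      Finset.measurable_sum _ fun i _ => hh.comp (measurable_pi_apply i)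
    simp only [weightedParticles_apply, Finset.sum_const, Finset.card_univ, Fintype.card_fin,
      nsmul_eq_mul]
    have hpt : ∀ x : Fin N → 𝓧, N * ∫⁻ u, h u ∂particleMeasure g x ≤
        (2 / z * b : ℝ≥0) * ∑ i, h (x i)
          + ({x : Fin N → 𝓧 | 0 ≤ ∑ i, ((z : ℝ) / 2 - g (x i))}.indicator
            fun x => N * ∑ i, h (x i)) x := fun x => by
      by_cases hx : 0 ≤ ∑ i, ((z : ℝ) / 2 - g (x i))
      · rw [Set.indicator_of_mem
          (s := {x : Fin N → 𝓧 | 0 ≤ ∑ i, ((z : ℝ) / 2 - g (x i))}) hx]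
        exact le_add_left (mul_le_mul_right (lintegral_particleMeasure_le g x hh) _)
      · refine le_add_right ?_
        rw [lintegral_particleMeasure g x hh, Finset.mul_sum, Finset.mul_sum]
        refine Finset.sum_le_sum fun i _ => ?_
        rw [← mul_assoc]
        gcongr
        exact_mod_cast natCast_mul_normWeight_le hb hz0 (not_le.1 hx) i
    calc _ ≤ _ := lintegral_mono hpt
      _ = (2 / z * b : ℝ≥0) * ∫⁻ x, ∑ i, h (x i) ∂Q N
          + N * ∫⁻ x in {x : Fin N → 𝓧 | 0 ≤ ∑ i, ((z : ℝ) / 2 - g (x i))}, ∑ i, h (x i) ∂Q N := by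
        rw [lintegral_add_left (hsum.const_mul _), lintegral_const_mul _ hsum,
          lintegral_indicator (hSet N), lintegral_const_mul _ hsum]
      _ ≤ (2 / z * b : ℝ≥0) * (C * N) + N * D := by
        gcongr
        · exact hC N
        · simpa using hD N
      _ = _ := by
        push_cast
        ring
  · obtain ⟨c, hfc⟩ := hfb
    have hgf : Measurable fun u => g u * f u := by fun_prop
    have hd := hc.deviation h hh hν (fun u => g u * f u) hgf
      ⟨b * c, fun u => by
        rw [abs_mul, NNReal.abs_eq]
        gcongr
        · exact_mod_cast hb u
        · exact hfc u⟩ (by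
        rw [integral_bayesUpdate hg] at hneg
        exact neg_of_mul_neg_right hneg hinv.le)
    simp only [lintegral_particle _ _ hh, integral_particle _ _ hgf] at hd
    refine hd.natCast_mul.mono fun N => ?_
    have hsum : Measurable fun y : Fin N → 𝓧 => ∑ i, h (y i) :=
      Finset.measurable_sum _ fun i _ => hh.comp (measurable_pi_apply i)
    simp only [weightedParticles_apply, Finset.sum_const, Finset.card_univ, Fintype.card_fin,
      nsmul_eq_mul]
    rw [← lintegral_const_mul _ hsum]
    refine (lintegral_mono_set fun x hx => ?_).trans
      (lintegral_mono fun x => mul_le_mul_right (lintegral_particleMeasure_le g x hh) _)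
    simp only [Set.mem_ofPred_eq] at hx ⊢
    rcases Nat.eq_zero_or_pos N with rfl | hN
    · simp
    have h1 : 0 ≤ ∫ u, f u ∂particleMeasure g x :=
      nonneg_of_mul_nonneg_right hx (by exact_mod_cast hN)
    rw [(integral_particleMeasure g x hf).2] at h1
    -- if all the likelihoods vanish, then so does the unnormalized sum, and the claim still holds
    by_cases hS : ∑ j, g (x j) = 0
    · have hg0 : ∀ j, g (x j) = 0 := fun j =>
        (Finset.sum_eq_zero_iff_of_nonneg fun _ _ => zero_le).1 hS j (Finset.mem_univ j)
      simp [hg0]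
    · have e : ∑ i, g (x i) * f (x i)
          = (∑ j, g (x j) : ℝ≥0) * ∑ i, (normWeight g x i : ℝ) * f (x i) := by
        rw [Finset.mul_sum]
        refine Finset.sum_congr rfl fun i _ => ?_
        rw [normWeight, if_neg hS, ← mul_assoc, ← NNReal.coe_mul, mul_div_cancel₀ _ hS]
      rw [e]
      positivity
  · have hgf : Measurable fun u => g u * f u := by fun_prop
    have h4 : ∫⁻ u, ‖g u * f u‖ₑ ^ 4 ∂ν < ∞ := by
      calc _ ≤ ∫⁻ u, (b : ℝ≥0∞) ^ 4 * ‖f u‖ₑ ^ 4 ∂ν := by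
            refine lintegral_mono fun u => ?_
            rw [← mul_pow, enorm_mul]
            gcongr
            simpa [Real.enorm_eq_ofReal_abs] using hb u
        _ = (b : ℝ≥0∞) ^ 4 * ∫⁻ u, ‖f u‖ₑ ^ 4 ∂ν := lintegral_const_mul _ (by fun_prop)
        _ < ∞ := ENNReal.mul_lt_top (by simp) hν
    obtain ⟨C, hC⟩ := hc.fourth _ hgf h4 (by
      rw [integral_bayesUpdate hg] at h0
      exact (mul_eq_zero.1 h0).resolve_left hinv.ne')
    obtain ⟨D, hD⟩ := hbad (fun u => ‖f u‖ₑ ^ 4) (by fun_prop) hν 2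
    simp only [integral_particle _ _ hgf] at hC
    refine ⟨(2 / z) ^ 4 * C + D, fun N => ?_⟩
    have hsum : Measurable fun y : Fin N → 𝓧 => ∑ i, ‖f (y i)‖ₑ ^ 4 :=
      Finset.measurable_sum _ fun i _ => by fun_prop
    simp only [weightedParticles_apply, Finset.sum_const, Finset.card_univ, Fintype.card_fin,
      nsmul_eq_mul]
    have hpt : ∀ x : Fin N → 𝓧, ‖N * ∫ u, f u ∂particleMeasure g x‖ₑ ^ 4 ≤
        ((2 / z : ℝ≥0) : ℝ≥0∞) ^ 4 * ‖∑ i, g (x i) * f (x i)‖ₑ ^ 4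
          + ({x : Fin N → 𝓧 | 0 ≤ ∑ i, ((z : ℝ) / 2 - g (x i))}.indicator
            fun x => (N : ℝ≥0∞) ^ 4 * ∑ i, ‖f (x i)‖ₑ ^ 4) x := fun x => by
      by_cases hx : 0 ≤ ∑ i, ((z : ℝ) / 2 - g (x i))
      · rw [Set.indicator_of_mem
          (s := {x : Fin N → 𝓧 | 0 ≤ ∑ i, ((z : ℝ) / 2 - g (x i))}) hx]
        refine le_add_left ?_
        rcases Nat.eq_zero_or_pos N with rfl | hN
        · simp
        have := isProbabilityMeasure_particleMeasure g x hN.ne'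
        rw [enorm_mul, mul_pow]
        gcongr
        · simp
        · exact (enorm_integral_pow_four_le _ hf).trans
            (lintegral_particleMeasure_le g x (h := fun u => ‖f u‖ₑ ^ 4) (by fun_prop))
      · refine le_add_right ?_
        rw [← mul_pow]
        gcongr
        have := abs_natCast_mul_integral_particleMeasure_le hz0 (not_le.1 hx) hf
        rw [Real.enorm_eq_ofReal_abs, Real.enorm_eq_ofReal_abs]
        refine (ENNReal.ofReal_le_ofReal this).trans ?_
        rw [ENNReal.ofReal_mul (by positivity)]
        gcongr
        rw [← ENNReal.ofReal_coe_nnreal]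
        simp
    calc _ ≤ _ := lintegral_mono hpt
      _ = ((2 / z : ℝ≥0) : ℝ≥0∞) ^ 4 * ∫⁻ x, ‖∑ i, g (x i) * f (x i)‖ₑ ^ 4 ∂Q N
          + (N : ℝ≥0∞) ^ 4 * ∫⁻ x in {x : Fin N → 𝓧 | 0 ≤ ∑ i, ((z : ℝ) / 2 - g (x i))},
              ∑ i, ‖f (x i)‖ₑ ^ 4 ∂Q N := by
        rw [lintegral_add_left (by fun_prop), lintegral_const_mul _ (by fun_prop),
          lintegral_indicator (hSet N), lintegral_const_mul _ hsum]
      _ ≤ ((2 / z : ℝ≥0) : ℝ≥0∞) ^ 4 * (C * N ^ 2) + N ^ 2 * D := by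
        refine add_le_add (mul_le_mul_right (hC N) _) ?_
        rw [show (N : ℝ≥0∞) ^ 4 = N ^ 2 * N ^ 2 by ring, mul_assoc]
        exact mul_le_mul_right (hD N) _
      _ = _ := by
        push_cast
        ring

/-- Conditional laws that are equal to the target, whatever the background state, are controlled. -/
theorem const_init (hμ : IsProbabilityMeasure μ) (Q : ∀ N, Measure (Fin N → 𝓧))
    [∀ N, IsProbabilityMeasure (Q N)] :
    IsControlled Q (fun N _ => Kernel.const (Fin N → 𝓧) μ) μ μ where
  prob := hμ
  prob_ref := hμ
  dominated := ⟨1, fun h _ => by simp⟩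
  moment h hh hν := by
    refine ⟨(∫⁻ z, h z ∂μ).toNNReal, fun N => ?_⟩
    rw [ENNReal.coe_toNNReal hν.ne]
    simp [mul_comm]
  deviation h hh hν g hg hgb hneg := by
    have hN : ∀ N : ℕ, 0 < N → ¬ 0 ≤ N * ∫ z, g z ∂μ := fun N hN =>
      not_le.2 (mul_neg_of_pos_of_neg (by exact_mod_cast hN) hneg)
    refine fun k => ⟨0, fun N => ?_⟩
    rcases Nat.eq_zero_or_pos N with rfl | h
    · simp
    · simp [hN N h]
  fourth f hf hν h0 := ⟨0, fun N => by simp [h0]⟩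

end IsControlled

/-! ### The filter as a conditional law -/

section Bayes

variable {α 𝓧 : Type*} [MeasurableSpace α] [MeasurableSpace 𝓧]

/-- Bayes' rule with a likelihood and a prior that depend measurably on a parameter. It is not Markov in
general, as `bayesUpdate` is the zero measure where the normalizer is `0` or `∞`, but its masses are
at most `1`. -/
noncomputable def bayesKernel (η : Kernel α 𝓧) [IsSFiniteKernel η] (g : α → 𝓧 → ℝ≥0)
    (hg : Measurable (Function.uncurry g)) : Kernel α 𝓧 where
  toFun a := bayesUpdate (g a) (η a)
  measurable' := by
    have hg' : Measurable (Function.uncurry fun a x => (g a x : ℝ≥0∞)) := hg.coe_nnreal_ennreal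
    have hZ : Measurable fun a => ∫⁻ x, g a x ∂η a := hg'.lintegral_kernel_prod_right
    refine Measure.measurable_of_measurable_coe _ fun s hs => ?_
    simp only [bayesUpdate, Measure.smul_apply, smul_eq_mul]
    refine hZ.inv.mul ?_
    simp_rw [← Kernel.withDensity_apply η hg']
    exact Kernel.measurable_coe _ hs

theorem bayesKernel_apply (η : Kernel α 𝓧) [IsSFiniteKernel η] (g : α → 𝓧 → ℝ≥0)
    (hg : Measurable (Function.uncurry g)) (a : α) :
    bayesKernel η g hg a = bayesUpdate (g a) (η a) := rfl

instance (η : Kernel α 𝓧) [IsSFiniteKernel η] (g : α → 𝓧 → ℝ≥0)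
    (hg : Measurable (Function.uncurry g)) : IsFiniteKernel (bayesKernel η g hg) := by
  refine ⟨1, ENNReal.one_lt_top, fun a => ?_⟩
  rw [bayesKernel_apply, ← lintegral_one,
    lintegral_bayesUpdate hg.of_uncurry_left _ measurable_const]
  simp only [mul_one]
  exact ENNReal.inv_mul_le_one _

end Bayes

theorem ProbabilityTheory.HasCondDistrib.lintegral_eq {Ω α β : Type*} [MeasurableSpace Ω]
    [MeasurableSpace α] [MeasurableSpace β] {P : Measure Ω} [SFinite P] {A : Ω → α} {B : Ω → β}
    {κ : Kernel α β} [IsSFiniteKernel κ] (h : HasCondDistrib B A κ P) (hA : Measurable A)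
    (hB : Measurable B) {f : α × β → ℝ≥0∞} (hf : Measurable f) :
    ∫⁻ ω, f (A ω, B ω) ∂P = ∫⁻ ω, ∫⁻ b, f (A ω, b) ∂κ (A ω) ∂P := by
  rw [← lintegral_map hf (hA.prodMk hB), HasLaw.map_eq h, Measure.lintegral_compProd hf,
    lintegral_map hf.lintegral_kernel_prod_right' hA]

theorem measurable_finSnoc {𝓨 : Type*} [MeasurableSpace 𝓨] (s : ℕ) :
    Measurable fun q : (Fin s → 𝓨) × 𝓨 => (Fin.snoc q.1 q.2 : Fin (s + 1) → 𝓨) := by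
  refine measurable_pi_iff.2 fun j => ?_
  refine Fin.lastCases ?_ (fun i => ?_) j
  · simpa using measurable_snd
  · simpa [Function.comp_def] using (measurable_pi_apply i).comp (measurable_fst (β := 𝓨))

theorem measurable_finInit {𝓨 : Type*} [MeasurableSpace 𝓨] (s : ℕ) :
    Measurable fun u : Fin (s + 1) → 𝓨 => (Fin.init u : Fin s → 𝓨) :=
  measurable_pi_iff.2 fun i => measurable_pi_apply i.castSucc

namespace StateSpaceModel

variable {𝓧 𝓨 : Type*} [MeasurableSpace 𝓧] [MeasurableSpace 𝓨] {lam : Measure 𝓨}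

theorem measurable_lik_last (M : StateSpaceModel 𝓧 𝓨 lam) (s : ℕ) :
    Measurable (Function.uncurry fun (u : Fin (s + 1) → 𝓨) x => M.lik (s + 1) x (u (Fin.last s))) :=
  (M.measurable_lik (s + 1)).comp
    (measurable_snd.prodMk ((measurable_pi_apply (Fin.last s)).comp measurable_fst))

/-- The optimal filter as a kernel from the outputs `y 1, …, y s`, bundled with its finiteness, which the
recursion needs. The output at time `j + 1` has index `j`. -/
noncomputable def finiteFilterKernel (M : StateSpaceModel 𝓧 𝓨 lam) :
    (s : ℕ) → {κ : Kernel (Fin s → 𝓨) 𝓧 // IsFiniteKernel κ}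
  | 0 => ⟨Kernel.const _ M.init, inferInstance⟩
  | s + 1 =>
    have := (M.finiteFilterKernel s).2
    ⟨bayesKernel ((M.trans s ∘ₖ (M.finiteFilterKernel s).1).comap Fin.init (measurable_finInit s))
      (fun u x => M.lik (s + 1) x (u (Fin.last s))) (M.measurable_lik_last s), inferInstance⟩

/-- The optimal filter as a kernel from the outputs `y 1, …, y s`, the output at time `j + 1` having
index `j`. Unlike `StateSpaceModel.filter` it sees no outputs at other times. -/
noncomputable def filterKernel (M : StateSpaceModel 𝓧 𝓨 lam) (s : ℕ) : Kernel (Fin s → 𝓨) 𝓧 :=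
  (M.finiteFilterKernel s).1

instance (M : StateSpaceModel 𝓧 𝓨 lam) (s : ℕ) : IsFiniteKernel (M.filterKernel s) :=
  (M.finiteFilterKernel s).2

theorem filterKernel_succ_apply (M : StateSpaceModel 𝓧 𝓨 lam) (s : ℕ) (u : Fin (s + 1) → 𝓨) :
    M.filterKernel (s + 1) u = bayesUpdate (fun x => M.lik (s + 1) x (u (Fin.last s)))
      ((M.filterKernel s (Fin.init u)).bind (M.trans s)) := by
  rw [filterKernel, finiteFilterKernel, bayesKernel_apply, Kernel.comap_apply, Kernel.comp_apply]
  rfl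

theorem filterKernel_apply (M : StateSpaceModel 𝓧 𝓨 lam) (y : ℕ → 𝓨) (s : ℕ) :
    M.filterKernel s (fun j => y (j + 1)) = M.filter y s := by
  induction s with
  | zero => rfl
  | succ s ih =>
    rw [filterKernel_succ_apply, filter, ← ih]
    rfl

variable {Ω : Type*} [MeasurableSpace Ω] {P : Measure Ω} {X : ℕ → Ω → 𝓧} {Y : ℕ → Ω → 𝓨}

theorem IsHiddenMarkov.measurable_history [SFinite lam] {M : StateSpaceModel 𝓧 𝓨 lam}
    (h : M.IsHiddenMarkov P X Y) (a b : ℕ) : Measurable (history X Y a b) :=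
  (measurable_pi_iff.2 fun _ => h.measurable_state _).prodMk
    (measurable_pi_iff.2 fun _ => h.measurable_output _)

theorem IsHiddenMarkov.measurable_outputs [SFinite lam] {M : StateSpaceModel 𝓧 𝓨 lam}
    (h : M.IsHiddenMarkov P X Y) (b : ℕ) : Measurable fun ω (j : Fin b) => Y (j + 1) ω :=
  measurable_pi_iff.2 fun _ => h.measurable_output _

/-- The joint law of the outputs up to time `s + 1` and the state at that time, in terms of the outputs
up to time `s` and the predictor, provided that the filter is the conditional law at time `s`. -/
theorem IsHiddenMarkov.lintegral_succ [SFinite lam] [IsProbabilityMeasure P]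
    {M : StateSpaceModel 𝓧 𝓨 lam} (h : M.IsHiddenMarkov P X Y) (s : ℕ)
    (ih : ∀ f : (Fin s → 𝓨) × 𝓧 → ℝ≥0∞, Measurable f →
      ∫⁻ ω, f (fun j : Fin s => Y (j + 1) ω, X s ω) ∂P =
      ∫⁻ ω, ∫⁻ x, f (fun j : Fin s => Y (j + 1) ω, x)
        ∂M.filterKernel s (fun j : Fin s => Y (j + 1) ω) ∂P)
    {f : (Fin (s + 1) → 𝓨) × 𝓧 → ℝ≥0∞} (hf : Measurable f) :
    ∫⁻ ω, f (fun j : Fin (s + 1) => Y (j + 1) ω, X (s + 1) ω) ∂P =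
    ∫⁻ ω, ∫⁻ y, ∫⁻ x, M.lik (s + 1) x y *
        f (Fin.snoc (fun j : Fin s => Y (j + 1) ω) y, x)
      ∂((M.filterKernel s (fun j : Fin s => Y (j + 1) ω)).bind (M.trans s)) ∂lam ∂P := by
  have hsnoc : ∀ ω, (fun j : Fin (s + 1) => Y (j + 1) ω)
      = Fin.snoc (fun j : Fin s => Y (j + 1) ω) (Y (s + 1) ω) := fun ω => by
    funext j
    refine Fin.lastCases ?_ (fun i => ?_) j <;> simp
  have hlik : Measurable fun q : 𝓧 × 𝓨 => (M.lik (s + 1) q.1 q.2 : ℝ≥0∞) :=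
    (M.measurable_lik (s + 1)).coe_nnreal_ennreal
  let J : ((Fin s → 𝓨) × 𝓧) × 𝓨 → ℝ≥0∞ := fun q =>
    M.lik (s + 1) q.1.2 q.2 * f (Fin.snoc q.1.1 q.2, q.1.2)
  have hsn : Measurable fun q : ((Fin s → 𝓨) × 𝓧) × 𝓨 =>
      ((Fin.snoc q.1.1 q.2, q.1.2) : (Fin (s + 1) → 𝓨) × 𝓧) :=
    ((measurable_finSnoc s).comp ((measurable_fst.comp measurable_fst).prodMk
      measurable_snd)).prodMk (measurable_snd.comp measurable_fst)
  have hJ : Measurable J :=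
    (hlik.comp ((measurable_snd.comp measurable_fst).prodMk measurable_snd)).mul (hf.comp hsn)
  let G : (Fin s → 𝓨) × 𝓧 → ℝ≥0∞ := fun q => ∫⁻ y, J (q, y) ∂lam
  have hG : Measurable G := hJ.lintegral_prod_right'
  have h1 := (h.obs s).lintegral_eq (h.measurable_history _ _) (h.measurable_output _)
    (f := fun q => f (Fin.snoc q.1.2 q.2, q.1.1 (Fin.last (s + 1))))
    (hf.comp (((measurable_finSnoc s).comp ((measurable_snd.comp measurable_fst).prodMk
      measurable_snd)).prodMk ((measurable_pi_apply _).comp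
        (measurable_fst.comp measurable_fst))))
  have h2 : ∀ ω, ∫⁻ y, f (Fin.snoc (history X Y (s + 1) s ω).2 y,
      (history X Y (s + 1) s ω).1 (Fin.last (s + 1))) ∂((M.obsKernel (s + 1)).comap
      (fun h : (Fin (s + 1 + 1) → 𝓧) × (Fin s → 𝓨) => h.1 (Fin.last (s + 1))) (by fun_prop))
        (history X Y (s + 1) s ω) = G (fun j : Fin s => Y (j + 1) ω, X (s + 1) ω) := fun ω => by
    rw [Kernel.comap_apply, obsKernel, Kernel.lintegral_withDensity _
      (M.measurable_lik (s + 1)).coe_nnreal_ennreal]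
    · rfl
    · exact hf.comp ((((measurable_finSnoc s).comp (measurable_const.prodMk
        measurable_id))).prodMk measurable_const)
  have h3 := (h.trans s).lintegral_eq (h.measurable_history _ _) (h.measurable_state _)
    (f := fun q => G (q.1.2, q.2))
    (hG.comp ((measurable_snd.comp measurable_fst).prodMk measurable_snd))
  have h4 := ih (fun q => ∫⁻ x, G (q.1, x) ∂M.trans s q.2) (by
    have : Measurable fun q : ((Fin s → 𝓨) × 𝓧) × 𝓧 => G (q.1.1, q.2) :=
      hG.comp ((measurable_fst.comp measurable_fst).prodMk measurable_snd)
    exact this.lintegral_kernel_prod_right' (κ := (M.trans s).comap Prod.snd measurable_snd))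
  calc _ = ∫⁻ ω, G (fun j : Fin s => Y (j + 1) ω, X (s + 1) ω) ∂P := by
        simp_rw [hsnoc, ← h2]
        exact h1
    _ = ∫⁻ ω, ∫⁻ x, ∫⁻ x', G (fun j : Fin s => Y (j + 1) ω, x') ∂M.trans s x
        ∂M.filterKernel s (fun j : Fin s => Y (j + 1) ω) ∂P := h3.trans h4
    _ = _ := by
        refine lintegral_congr fun ω => ?_
        set u := fun j : Fin s => Y (j + 1) ω
        have hGu : Measurable fun x => G (u, x) := hG.comp (measurable_const.prodMk measurable_id)
        rw [← Measure.lintegral_bind (M.trans s).measurable.aemeasurable hGu.aemeasurable]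
        refine lintegral_lintegral_swap (Measurable.aemeasurable ?_)
        exact hJ.comp ((measurable_const.prodMk measurable_fst).prodMk measurable_snd)

/-- The filter is the conditional law of the state at time `s` given the outputs, in integrated form. -/
theorem IsHiddenMarkov.lintegral_eq [SFinite lam] [IsProbabilityMeasure P]
    {M : StateSpaceModel 𝓧 𝓨 lam} (h : M.IsHiddenMarkov P X Y) (s : ℕ)
    {f : (Fin s → 𝓨) × 𝓧 → ℝ≥0∞} (hf : Measurable f) :
    ∫⁻ ω, f (fun j : Fin s => Y (j + 1) ω, X s ω) ∂P =
    ∫⁻ ω, ∫⁻ x, f (fun j : Fin s => Y (j + 1) ω, x)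
      ∂M.filterKernel s (fun j : Fin s => Y (j + 1) ω) ∂P := by
  induction s with
  | zero =>
    have hu : ∀ ω, (fun j : Fin 0 => Y (j + 1) ω) = Fin.elim0 := fun ω => Subsingleton.elim _ _
    have hfu : Measurable fun x => f (Fin.elim0, x) := hf.comp (measurable_const.prodMk measurable_id)
    simp only [hu, lintegral_const, measure_univ, mul_one]
    rw [← lintegral_map hfu (h.measurable_state 0), h.init.map_eq]
    rfl
  | succ s ih =>
    have ih' := fun f hf => ih (f := f) hf
    -- the right-hand side is again an integral against the joint law, of a function that depends on
    -- the outputs alone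
    rw [h.lintegral_succ s ih' hf, h.lintegral_succ s ih'
      (f := fun q => ∫⁻ x, f (q.1, x) ∂M.filterKernel (s + 1) q.1) (by
        have : Measurable fun v => ∫⁻ x, f (v, x) ∂M.filterKernel (s + 1) v :=
          hf.lintegral_kernel_prod_right'
        exact this.comp measurable_fst)]
    refine lintegral_congr fun ω => ?_
    set u := fun j : Fin s => Y (j + 1) ω
    set μ := (M.filterKernel s u).bind (M.trans s) with hμ
    have hlik : Measurable fun q : 𝓧 × 𝓨 => (M.lik (s + 1) q.1 q.2 : ℝ≥0∞) :=
      (M.measurable_lik (s + 1)).coe_nnreal_ennreal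
    -- the normalizer is finite for almost every `y`, since its integral is the mass of the predictor
    have hZ : ∫⁻ y, ∫⁻ x, M.lik (s + 1) x y ∂μ ∂lam ≠ ∞ := by
      have hsw : Measurable (Function.uncurry fun y x => (M.lik (s + 1) x y : ℝ≥0∞)) :=
        hlik.comp measurable_swap
      rw [lintegral_lintegral_swap hsw.aemeasurable]
      simp only [M.lintegral_lik, lintegral_one]
      exact measure_ne_top _ _
    refine lintegral_congr_ae ?_
    filter_upwards [ae_lt_top (hlik.lintegral_prod_left' (μ := μ)) hZ] with y hy
    have hg := M.measurable_lik_left (s + 1) y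
    have hfy : Measurable fun x => f (Fin.snoc u y, x) :=
      hf.comp (measurable_const.prodMk measurable_id)
    simp only [filterKernel_succ_apply, Fin.snoc_last, Fin.init_snoc]
    rw [lintegral_bayesUpdate hg _ hfy, lintegral_mul_const _ hg.coe_nnreal_ennreal, ← hμ]
    -- where the normalizer vanishes, both sides do
    by_cases h0 : ∫⁻ x, M.lik (s + 1) x y ∂μ = 0
    · rw [h0, zero_mul]
      rw [lintegral_eq_zero_iff hg.coe_nnreal_ennreal] at h0
      refine lintegral_eq_zero_of_ae_eq_zero ?_
      filter_upwards [h0] with x hx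
      simp only [Pi.zero_apply] at hx ⊢
      rw [hx, zero_mul]
    · rw [← mul_assoc, ENNReal.mul_inv_cancel h0 hy.ne, one_mul]

theorem IsHiddenMarkov.condExp_ae_eq [SFinite lam] [IsProbabilityMeasure P]
    [StandardBorelSpace 𝓧] [Nonempty 𝓧] {M : StateSpaceModel 𝓧 𝓨 lam} (h : M.IsHiddenMarkov P X Y)
    (t : ℕ) {F : Type*} [NormedAddCommGroup F] [NormedSpace ℝ F] [CompleteSpace F] {φ : 𝓧 → F}
    (hφ : StronglyMeasurable φ) (hi : Integrable (fun ω => φ (X t ω)) P) :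
    P[fun ω => φ (X t ω) | outputSigma Y t] =ᵐ[P]
      fun ω => ∫ x, φ x ∂(M.filter (fun s => Y s ω) t) := by
  have hU := h.measurable_outputs t
  have hX := h.measurable_state t
  have hmap : P.map (fun ω => ((fun j : Fin t => Y (j + 1) ω), X t ω))
      = P.map (fun ω (j : Fin t) => Y (j + 1) ω) ⊗ₘ M.filterKernel t := by
    refine Measure.ext_of_lintegral _ fun f hf => ?_
    rw [lintegral_map hf (hU.prodMk hX), Measure.lintegral_compProd hf,
      lintegral_map hf.lintegral_kernel_prod_right' hU]
    exact h.lintegral_eq t hf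
  have hcd := ae_of_ae_map hU.aemeasurable
    (condDistrib_ae_eq_of_measure_eq_compProd _ hX.aemeasurable hmap)
  refine (condExp_ae_eq_integral_condDistrib hU hX.aemeasurable hφ hi).trans ?_
  filter_upwards [hcd] with ω hω
  rw [hω, ← filterKernel_apply]

end StateSpaceModel

/-! ### Convergence of the particle filter -/

/-- A sequence whose fourth moments about `c` are of order `N⁻²` converges to `c` almost surely, without
any assumption on the joint law. -/
theorem ae_tendsto_of_lintegral_pow_four_le {Ω : Type*} [MeasurableSpace Ω] {P : Measure Ω}
    {Z : ℕ → Ω → ℝ} (hZ : ∀ N, AEMeasurable (Z N) P) {c : ℝ} {C : ℝ≥0}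
    (hC : ∀ N : ℕ, 1 ≤ N → ∫⁻ ω, ‖Z N ω - c‖ₑ ^ 4 ∂P ≤ (C : ℝ≥0∞) / (N : ℝ≥0∞) ^ 2) :
    ∀ᵐ ω ∂P, Tendsto (fun N => Z N ω) atTop (𝓝 c) := by
  have hm : ∀ N, AEMeasurable (fun ω => ‖Z N ω - c‖ₑ ^ 4) P := fun N =>
    ((hZ N).sub_const c).enorm.pow_const 4
  have hsum : ∫⁻ ω, ∑' N : ℕ, ‖Z (N + 1) ω - c‖ₑ ^ 4 ∂P ≠ ∞ := by
    rw [lintegral_tsum fun N => hm (N + 1)]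
    have hs : Summable fun N : ℕ => C / ((N + 1 : ℕ) : ℝ≥0) ^ 2 := by
      rw [← NNReal.summable_coe]
      have := ((summable_nat_add_iff 1).2
        (Real.summable_one_div_nat_pow.2 (one_lt_two))).mul_left (C : ℝ)
      refine this.congr fun N => ?_
      push_cast
      ring
    refine ne_top_of_le_ne_top (ENNReal.tsum_coe_ne_top_iff_summable.2 hs)
      (ENNReal.tsum_le_tsum fun N => (hC (N + 1) (Nat.le_add_left 1 N)).trans (le_of_eq ?_))
    rw [ENNReal.coe_div (by positivity)]
    push_cast
    rfl
  filter_upwards [ae_lt_top' (AEMeasurable.tsum fun N => hm (N + 1)) hsum] with ω hω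
  have h1 := ENNReal.tendsto_atTop_zero_of_tsum_ne_top hω.ne
  -- the shift avoids `N = 0`, where the bound is `C / 0`
  refine (tendsto_add_atTop_iff_nat 1).1 (tendsto_iff_edist_tendsto_0.2 ?_)
  have h2 := (ENNReal.continuous_rpow_const (y := (1 / 4 : ℝ))).tendsto 0 |>.comp h1
  rw [ENNReal.zero_rpow_of_pos (by norm_num)] at h2
  refine h2.congr fun N => ?_
  simp only [Function.comp_apply]
  rw [← ENNReal.rpow_natCast, ← ENNReal.rpow_mul, edist_eq_enorm_sub]
  norm_num

namespace StateSpaceModel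

variable {𝓧 𝓨 : Type*} [MeasurableSpace 𝓧] [MeasurableSpace 𝓨] {lam : Measure 𝓨}

theorem isControlled_particleLaw (M : StateSpaceModel 𝓧 𝓨 lam) (y : ℕ → 𝓨) (s : ℕ)
    (hc : IsControlled (fun N => M.resampledLaw y N s) particle (M.filter y s) (M.stateLaw s)) :
    IsControlled (fun N => M.particleLaw y N (s + 1)) particle (M.predictor y s)
      (M.stateLaw (s + 1)) :=
  (hc.propagation (M.trans s)).sampling (fun N i x => by
    rw [Kernel.comap_apply]
    infer_instance) (fun N => propagate N (M.trans s)) fun _ _ => rfl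

theorem isControlled_weightedParticles (M : StateSpaceModel 𝓧 𝓨 lam) (y : ℕ → 𝓨) (s : ℕ)
    (hc : IsControlled (fun N => M.resampledLaw y N s) particle (M.filter y s) (M.stateLaw s))
    (hb : BddAbove (Set.range fun x => M.lik (s + 1) x (y (s + 1))))
    (hZ : ∫⁻ x, M.lik (s + 1) x (y (s + 1)) ∂(M.predictor y s) ≠ 0) :
    IsControlled (fun N => M.particleLaw y N (s + 1))
      (fun N _ => weightedParticles _ (M.measurable_lik_left (s + 1) (y (s + 1))) N)
      (M.filter y (s + 1)) (M.stateLaw (s + 1)) := by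
  obtain ⟨b, hb⟩ := hb
  exact (M.isControlled_particleLaw y s hc).reweighting _ (fun u => hb ⟨u, rfl⟩) hZ

theorem isControlled_resampledLaw (M : StateSpaceModel 𝓧 𝓨 lam) (y : ℕ → 𝓨) (s : ℕ)
    (hb : ∀ r, 1 ≤ r → r ≤ s → BddAbove (Set.range fun x => M.lik r x (y r)))
    (hZ : ∀ r < s, ∫⁻ x, M.lik (r + 1) x (y (r + 1)) ∂(M.predictor y r) ≠ 0) :
    IsControlled (fun N => M.resampledLaw y N s) particle (M.filter y s) (M.stateLaw s) := by
  induction s with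
  | zero =>
    have h := (IsControlled.const_init M.prob_init
      fun N => Measure.pi fun _ : Fin N => M.init).sampling (fun N i x => by
        rw [Kernel.const_apply]
        infer_instance) (fun N => Kernel.const _ (Measure.pi fun _ => M.init)) fun _ _ => rfl
    simp only [Measure.const_comp, measure_univ, one_smul] at h
    exact h
  | succ s ih =>
    exact (M.isControlled_weightedParticles y s
      (ih (fun r h1 h2 => hb r h1 (h2.trans s.le_succ)) fun r h => hZ r (h.trans s.lt_succ_self))
      (hb _ (Nat.le_add_left 1 s) le_rfl) (hZ s s.lt_succ_self)).sampling
        (fun N i x => isProbabilityMeasure_particleMeasure _ _ i.pos.ne')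
        (fun N => resample N _ (M.measurable_lik_left _ _)) fun _ _ => rfl

theorem measurable_integral_particleFilter (M : StateSpaceModel 𝓧 𝓨 lam) (y : ℕ → 𝓨) (t N : ℕ)
    {φ : 𝓧 → ℝ} (hφ : Measurable φ) :
    Measurable fun x : Fin N → 𝓧 => ∫ z, φ z ∂(M.particleFilter y t x) :=
  (hφ.stronglyMeasurable.integral_kernel
    (κ := weightedParticles _ (M.measurable_lik_left t (y t)) N)).measurable

theorem exists_fourth_moment_bound (M : StateSpaceModel 𝓧 𝓨 lam) (y : ℕ → 𝓨) (t : ℕ)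
    (hc : IsControlled (fun N => M.particleLaw y N t)
      (fun N _ => weightedParticles _ (M.measurable_lik_left t (y t)) N)
      (M.filter y t) (M.stateLaw t)) {φ : 𝓧 → ℝ} (hφ : Measurable φ)
    (h4 : ∫⁻ x, ‖φ x‖ₑ ^ 4 ∂(M.stateLaw t) < ∞) :
    ∃ C : ℝ≥0, ∀ N : ℕ, 1 ≤ N →
      ∫⁻ x, ‖(∫ z, φ z ∂(M.particleFilter y t x)) - ∫ z, φ z ∂(M.filter y t)‖ₑ ^ 4
        ∂(M.particleLaw y N t) ≤ (C : ℝ≥0∞) / (N : ℝ≥0∞) ^ 2 := by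
  have := hc.prob
  have := hc.prob_ref
  set c := ∫ z, φ z ∂(M.filter y t) with hcdef
  have hφi := hc.integrable hφ h4
  obtain ⟨C, hC⟩ := hc.fourth (fun z => φ z - c) (hφ.sub_const c)
    (lintegral_enorm_pow_four_lt_top ((memLp_four_of_lintegral_lt_top
      hφ.aestronglyMeasurable h4).sub (memLp_const c)))
    (by rw [integral_sub hφi (integrable_const _)]; simp [hcdef])
  refine ⟨C, fun N hN => ?_⟩
  have hN0 : (N : ℝ≥0∞) ≠ 0 := by exact_mod_cast (Nat.one_le_iff_ne_zero.1 hN)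
  have hNt : (N : ℝ≥0∞) ≠ ∞ := ENNReal.natCast_ne_top N
  have e : ∀ x : Fin N → 𝓧, ‖∑ _i : Fin N, ∫ z, (φ z - c)
      ∂weightedParticles _ (M.measurable_lik_left t (y t)) N x‖ₑ ^ 4
      = (N : ℝ≥0∞) ^ 4 * ‖(∫ z, φ z ∂(M.particleFilter y t x)) - c‖ₑ ^ 4 := fun x => by
    have := isProbabilityMeasure_particleMeasure (fun z => M.lik t z (y t)) x
      (Nat.one_le_iff_ne_zero.1 hN)
    rw [weightedParticles_apply, integral_sub (integral_particleMeasure _ x hφ).1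
      (integrable_const _), Finset.sum_const, Finset.card_univ, Fintype.card_fin, nsmul_eq_mul,
      enorm_mul, mul_pow]
    simp [particleFilter]
  have h := hC N
  have hm := M.measurable_integral_particleFilter y t N hφ
  simp only [e] at h
  rw [lintegral_const_mul _ ((hm.sub_const c).enorm.pow_const 4)] at h
  rw [ENNReal.le_div_iff_mul_le (Or.inl (pow_ne_zero 2 hN0)) (Or.inl (ENNReal.pow_ne_top hNt))]
  refine (ENNReal.mul_le_mul_iff_right (pow_ne_zero 2 hN0) (ENNReal.pow_ne_top hNt)).1
    (le_trans (le_of_eq ?_) (h.trans (le_of_eq (mul_comm _ _))))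
  ring

theorem particleEstimate_apply {n : ℕ} (M : StateSpaceModel (EuclideanSpace ℝ (Fin n)) 𝓨 lam)
    (y : ℕ → 𝓨) (t : ℕ) {N : ℕ} (x : Fin N → EuclideanSpace ℝ (Fin n)) (j : Fin n) :
    M.particleEstimate y t x j = ∫ z, z j ∂(M.particleFilter y t x) := by
  rw [particleFilter, (integral_particleMeasure _ x (by fun_prop)).2, particleEstimate]
  simp

theorem ae_tendsto_particleEstimate {n : ℕ}
    (M : StateSpaceModel (EuclideanSpace ℝ (Fin n)) 𝓨 lam) (y : ℕ → 𝓨) (t : ℕ)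
    (hc : IsControlled (fun N => M.particleLaw y N t)
      (fun N _ => weightedParticles _ (M.measurable_lik_left t (y t)) N)
      (M.filter y t) (M.stateLaw t))
    (h4 : ∫⁻ x, ‖x‖ₑ ^ 4 ∂(M.stateLaw t) < ∞) (hi : Integrable (fun x => x) (M.filter y t))
    {Ω : Type*} [MeasurableSpace Ω] {P : Measure Ω}
    {ξ : (N : ℕ) → Ω → Fin N → EuclideanSpace ℝ (Fin n)}
    (hξ : ∀ N, HasLaw (ξ N) (M.particleLaw y N t) P) :
    ∀ᵐ ω ∂P, Tendsto (fun N => M.particleEstimate y t (ξ N ω)) atTop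
      (𝓝 (∫ x, x ∂(M.filter y t))) := by
  have hj : ∀ j : Fin n, ∀ᵐ ω ∂P, Tendsto (fun N => M.particleEstimate y t (ξ N ω) j) atTop
      (𝓝 ((∫ x, x ∂(M.filter y t)) j)) := fun j => by
    have hφ : Measurable fun x : EuclideanSpace ℝ (Fin n) => x j := by fun_prop
    obtain ⟨C, hC⟩ := M.exists_fourth_moment_bound y t hc hφ
      (lt_of_le_of_lt (lintegral_mono fun x => by
        gcongr
        exact enorm_le_iff_norm_le.2 (PiLp.norm_apply_le x j)) h4)
    have e : (∫ x, x ∂(M.filter y t)) j = ∫ x, x j ∂(M.filter y t) :=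
      ((EuclideanSpace.proj (𝕜 := ℝ) j).integral_comp_comm hi).symm
    simp only [particleEstimate_apply, e]
    have hm := fun N => M.measurable_integral_particleFilter y t N hφ
    refine ae_tendsto_of_lintegral_pow_four_le (C := C)
      (fun N => (hm N).comp_aemeasurable (hξ N).aemeasurable) fun N hN => ?_
    refine le_trans (le_of_eq ?_) (hC N hN)
    rw [← (hξ N).map_eq, lintegral_map' (((hm N).sub_const _).enorm.pow_const 4).aemeasurable
      (hξ N).aemeasurable]
    rfl
  filter_upwards [ae_all_iff.2 hj] with ω hω
  exact ((PiLp.continuous_toLp 2 _).tendsto _).comp (tendsto_pi_nhds.2 hω)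

end StateSpaceModel

theorem proposition3 {n : ℕ} {𝓨 : Type*} [MeasurableSpace 𝓨] (lam : Measure 𝓨) [SigmaFinite lam]
    (M : StateSpaceModel (EuclideanSpace ℝ (Fin n)) 𝓨 lam) (t : ℕ) (ht : 1 ≤ t) :
    -- the recursively defined optimal filter is the conditional law of the state
    (∀ (Ω : Type*) [MeasurableSpace Ω] (P : Measure Ω) [IsProbabilityMeasure P]
        (X : ℕ → Ω → EuclideanSpace ℝ (Fin n)) (Y : ℕ → Ω → 𝓨), M.IsHiddenMarkov P X Y →
      (∀ φ : EuclideanSpace ℝ (Fin n) → ℝ, Measurable φ → Integrable (fun ω => φ (X t ω)) P →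
        P[fun ω => φ (X t ω) | StateSpaceModel.outputSigma Y t]
          =ᵐ[P] fun ω => ∫ x, φ x ∂(M.filter (fun s => Y s ω) t)) ∧
      (Integrable (X t) P →
        P[X t | StateSpaceModel.outputSigma Y t]
          =ᵐ[P] fun ω => ∫ x, x ∂(M.filter (fun s => Y s ω) t))) ∧
    -- fixed outputs `y 1, …, y t` with bounded likelihoods and nonvanishing normalizers
    (∀ y : ℕ → 𝓨,
      (∀ s, 1 ≤ s → s ≤ t → BddAbove (Set.range fun x => M.lik s x (y s))) →
      (∀ s < t, ∫⁻ x, M.lik (s + 1) x (y (s + 1)) ∂(M.predictor y s) ≠ 0) →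
      -- fourth-moment bound
      (∀ φ : EuclideanSpace ℝ (Fin n) → ℝ, Measurable φ →
        ∫⁻ x, ‖φ x‖ₑ ^ 4 ∂(M.stateLaw t) < ∞ →
        Integrable φ (M.filter y t) ∧
        ∃ C : ℝ≥0, ∀ N : ℕ, 1 ≤ N →
          ∫⁻ x, ‖(∫ z, φ z ∂(M.particleFilter y t x)) - ∫ z, φ z ∂(M.filter y t)‖ₑ ^ 4
            ∂(M.particleLaw y N t) ≤ (C : ℝ≥0∞) / (N : ℝ≥0∞) ^ 2) ∧
      -- almost sure convergence of the state estimate, for every joint law of the clouds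
      (∫⁻ x, ‖x‖ₑ ^ 4 ∂(M.stateLaw t) < ∞ →
        Integrable (fun x => x) (M.filter y t) ∧
        ∀ (Ω : Type*) [MeasurableSpace Ω] (P : Measure Ω) [IsProbabilityMeasure P]
          (ξ : (N : ℕ) → Ω → Fin N → EuclideanSpace ℝ (Fin n)),
          (∀ N, HasLaw (ξ N) (M.particleLaw y N t) P) →
          ∀ᵐ ω ∂P, Tendsto (fun N => M.particleEstimate y t (ξ N ω)) atTop
            (𝓝 (∫ x, x ∂(M.filter y t))))) := by
  refine ⟨fun Ω _ P _ X Y h => ⟨fun φ hφ hi => h.condExp_ae_eq t hφ.stronglyMeasurable hi,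
    fun hi => h.condExp_ae_eq t stronglyMeasurable_id hi⟩, fun y hb hZ => ?_⟩
  obtain ⟨s, rfl⟩ := Nat.exists_eq_add_of_le' ht
  have hc := M.isControlled_weightedParticles y s
    (M.isControlled_resampledLaw y s (fun r h1 h2 => hb r h1 (h2.trans s.le_succ))
      fun r h => hZ r (h.trans s.lt_succ_self)) (hb _ ht le_rfl) (hZ s s.lt_succ_self)
  have := hc.prob
  refine ⟨fun φ hφ h4 => ⟨hc.integrable hφ h4, M.exists_fourth_moment_bound y _ hc hφ h4⟩,
    fun h4 => ?_⟩
  have hi : Integrable (fun x => x) (M.filter y (s + 1)) :=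
    (memLp_four_of_lintegral_lt_top (by fun_prop)
      (hc.lintegral_lt_top (by fun_prop) h4)).integrable (by norm_num)
  exact ⟨hi, fun Ω _ P _ ξ hξ => M.ae_tendsto_particleEstimate y _ hc h4 hi hξ⟩
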